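/- **Setting.** Let $M$ be a smooth (Hausdorff, finite-dimensional, boundaryless) manifold, $\pi:TM\setminus 0\to M$ its slit tangent bundle, $\mathscr V TM=\ker d\pi$ the vertical bundle over $TM\setminus 0$, $i_w:T_{\pi(w)}M\to\mathscr V_wTM$, $i_w(u)=\frac{d}{dt}|_{t=0}(w+tu)$, the vertical lift, $C(w)=i_w(w)$ the canonical field, and $\mathscr J(X)=i_w(d\pi(X))$, $X\in T_w(TM\setminus0)$, the almost-tangent structure. For a vector field $V$ on $M$ put $V^{\mathfrak v}(w)=i_w(V(\pi(w)))$. Let $S$ be a spray, i.e. a smooth vector field on $TM\setminus 0$ with $\mathscr J(S)=C$ and $[C,S]=S$; its geodesics are the curves $\gamma$ in $M$ for which $\dot\gamma$ takes values in $TM\setminus0$ and is an integral curve of $S$. Let $\Gamma_S=-[S,\mathscr J]$ (minus the Lie derivative of $\mathscr J$ along $S$); vectors in $\ker(\Gamma_S-I)$ are called horizontal, and $u^{\mathfrak h}$ denotes the horizontal lift at $w$ of $u\in T_{\pi(w)}M$. Let $\nabla$ be a smooth linear connection on $\mathscr VTM\to TM\setminus 0$ which is a lift of $\Gamma_S$,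 i.e. $\nabla_XC=X$ for all vertical $X$ and $\{X:\nabla_XC=0\}$ is the horizontal distribution of $\Gamma_S$. Its torsion is $\mathrm T(X,Y)=\nabla_X\mathscr J(Y)-\nabla_Y\mathscr J(X)-\mathscr J[X,Y]$, its curvature is $\mathcal R(X,Y)Z=\nabla_{[X,Y]}Z-[\nabla_X,\nabla_Y]Z$ ($Z$ vertical), and the curvature endomorphism in the direction $w\in TM\setminus0$ is $\mathbf R_w(u)=i_w^{-1}\mathcal R(S,u^{\mathfrak h})C$, $u\in T_{\pi(w)}M$. Put $D^w_uV=i_w^{-1}\nabla_{u^{\mathfrak h}}V^{\mathfrak v}$. For a nowhere null vector field $W$ on an open set $\mathcal O\subseteq M$, let $(D^W_UV)(x)=D^{W(x)}_{U(x)}V$, and for a nowhere null field $W$ along a curve let $D^W/dt$ be the covariant derivative along the curve that $D^{W(t)}$ induces at each time $t$. **Assume (T1):** $\mathrm T(S,Y)=0$ for all vector fields $Y$ on $TM\setminus 0$. **(1)** Let $I\subseteq\mathbb R$ be a nondegenerate interval and $H:(-\varepsilon,\varepsilon)\times I\to M$ a smooth variation through regular curves, i.e. $T=\partial H/\partial t$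 vanishes nowhere; put $U=\partial H/\partial s$, and let $D^T/dt$, $D^T/ds$ be the covariant derivatives along the curves $t\mapsto H(s,t)$, $s\mapsto H(s,t)$ corresponding to $T$. If $\lambda(t)=H(0,t)$ is a geodesic of $S$, then at every $(0,t)$, $t\in I$, $$\frac{D^T}{ds}\frac{D^TT}{dt}-\frac{D^T}{dt}\frac{D^TT}{ds}=\mathbf R_T(U).$$ **(2)** If in addition every curve $t\mapsto H(s,t)$ is a geodesic of $S$, then $J(t)=U(0,t)$ satisfies on $I$ the Jacobi equation $$\frac{(D^{\dot\lambda})^2J}{dt^2}+\mathbf R_{\dot\lambda}(J)=0.$$ **(3)** Let $W$ be a smooth nowhere null vector field on an open set $\mathcal O\subseteq M$ whose integral curve through some point $x_0\in\mathcal O$ is a geodesic of $S$. Then for every smooth vector field $U$ on $\mathcal O$, at $x_0$, $$D^W_UD^W_WW-D^W_WD^W_UW+D^W_{[W,U]}W=\mathbf R_W(U).$$ -/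

import Mathlib

open Set
open scoped Manifold ContDiff Bundle

noncomputable section

namespace SprayGeometry

section

variable {E : Type*} [NormedAddCommGroup E] [NormedSpace ℝ E]
  {M : Type*} [TopologicalSpace M] [ChartedSpace E M] [IsManifold 𝓘(ℝ, E) ∞ M]

/-! ### Vector fields on the tangent bundle

Vector fields on (open subsets of) the slit tangent bundle `TM \ 0` are represented by functions
defined on all of `TM`; only their values on `TM \ 0` are ever constrained or used. -/

variable (E M) in
/-- The slit tangent bundle `TM \ 0`, an open subset of `TM`. -/
def slit : Set (TangentBundle 𝓘(ℝ, E) M) := {w | w.2 ≠ 0}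

/-- The tangent space `T_w TM`. -/
abbrev TTangent (w : TangentBundle 𝓘(ℝ, E) M) : Type _ := TangentSpace 𝓘(ℝ, E).tangent w

/-- `X` is a smooth vector field on the subset `O` of `M`. -/
def SmoothFieldOn (X : (x : M) → TangentSpace 𝓘(ℝ, E) x) (O : Set M) : Prop :=
  ContMDiffOn 𝓘(ℝ, E) 𝓘(ℝ, E).tangent ∞ (fun x => (⟨x, X x⟩ : TangentBundle 𝓘(ℝ, E) M)) O

/-- `X` is a smooth vector field on the subset `O` of `TM`. -/
def SmoothTFieldOn (X : (w : TangentBundle 𝓘(ℝ, E) M) → TTangent w)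
    (O : Set (TangentBundle 𝓘(ℝ, E) M)) : Prop :=
  ContMDiffOn 𝓘(ℝ, E).tangent 𝓘(ℝ, E).tangent.tangent ∞
    (fun w => (⟨w, X w⟩ : TangentBundle 𝓘(ℝ, E).tangent (TangentBundle 𝓘(ℝ, E) M))) O

/-- The Lie bracket of vector fields on `TM`. -/
def bracket (X Y : (w : TangentBundle 𝓘(ℝ, E) M) → TTangent w)
    (w : TangentBundle 𝓘(ℝ, E) M) : TTangent w :=
  VectorField.mlieBracket 𝓘(ℝ, E).tangent X Y w

/-- A local extension of the vector `ξ ∈ T_w TM` to a vector field, smooth near `w`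
(constant in the preferred chart at `w`). Used to evaluate tensors at a point. -/
def extT {w : TangentBundle 𝓘(ℝ, E) M} (ξ : TTangent w) :
    (z : TangentBundle 𝓘(ℝ, E) M) → TTangent z :=
  FiberBundle.extend (E × E) ξ

/-- A local extension of the vector `u ∈ T_x M` to a vector field, smooth near `x`
(constant in the preferred chart at `x`). -/
def extM {x : M} (u : TangentSpace 𝓘(ℝ, E) x) : (y : M) → TangentSpace 𝓘(ℝ, E) y :=
  FiberBundle.extend E u

/-! ### The vertical distribution, vertical lifts, the almost-tangent structure -/

/-- The differential `dπ(w) : T_w TM → T_{π(w)} M` of the projection `π`. -/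
def dproj (w : TangentBundle 𝓘(ℝ, E) M) : TTangent w →L[ℝ] TangentSpace 𝓘(ℝ, E) w.1 :=
  mfderiv 𝓘(ℝ, E).tangent 𝓘(ℝ, E) (fun z : TangentBundle 𝓘(ℝ, E) M => z.1) w

/-- `ξ ∈ T_w TM` is vertical if it lies in the kernel of `dπ(w)`. -/
def IsVertical {w : TangentBundle 𝓘(ℝ, E) M} (ξ : TTangent w) : Prop := dproj w ξ = 0

/-- The vertical lift `i_w(u) = (d/dt)|_{t=0} (w + t u)`. -/
def vlift (w : TangentBundle 𝓘(ℝ, E) M) (u : TangentSpace 𝓘(ℝ, E) w.1) : TTangent w :=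
  mfderiv 𝓘(ℝ, ℝ) 𝓘(ℝ, E).tangent
    (fun t : ℝ => (⟨w.1, w.2 + t • u⟩ : TangentBundle 𝓘(ℝ, E) M)) 0 (1 : ℝ)

/-- The inverse `i_w⁻¹ : V_w TM → T_{π(w)} M` of the isomorphism `i_w`. -/
def vliftInv (w : TangentBundle 𝓘(ℝ, E) M) (ξ : TTangent w) : TangentSpace 𝓘(ℝ, E) w.1 :=
  Function.invFun (vlift w) ξ

/-- The vertical lift `V^v` of a vector field `V` on (an open subset of) `M`. -/
def vliftField (V : (x : M) → TangentSpace 𝓘(ℝ, E) x) (w : TangentBundle 𝓘(ℝ, E) M) :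
    TTangent w :=
  vlift w (V w.1)

/-- The canonical vertical vector field `C(w) = i_w(w)`. -/
def canonicalField (w : TangentBundle 𝓘(ℝ, E) M) : TTangent w := vlift w w.2

/-- The almost-tangent structure `J(ξ) = i_w(dπ(ξ))`. -/
def almostTangent (w : TangentBundle 𝓘(ℝ, E) M) (ξ : TTangent w) : TTangent w :=
  vlift w (dproj w ξ)

/-- The almost-tangent structure applied to a vector field. -/
def almostTangentField (X : (w : TangentBundle 𝓘(ℝ, E) M) → TTangent w)
    (w : TangentBundle 𝓘(ℝ, E) M) : TTangent w :=
  almostTangent w (X w)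

/-! ### Sprays and their canonical connections -/

/-- `S` is a spray: a smooth vector field on `TM \ 0` with `J(S) = C` and `[C, S] = S`. -/
structure IsSpray (S : (w : TangentBundle 𝓘(ℝ, E) M) → TTangent w) : Prop where
  smooth : SmoothTFieldOn S (slit E M)
  almostTangent_eq : ∀ w ∈ slit E M, almostTangent w (S w) = canonicalField w
  homogeneous : ∀ w ∈ slit E M, bracket canonicalField S w = S w

/-- The canonical connection `Γ_S = -[S, J]` of `S`, where `[S, J]` is the Lie derivative of the
tensor field `J` along `S`, that is `[S, J](X) = [S, J X] - J [S, X]`. -/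
def canonicalConnection (S : (w : TangentBundle 𝓘(ℝ, E) M) → TTangent w)
    (w : TangentBundle 𝓘(ℝ, E) M) (ξ : TTangent w) : TTangent w :=
  -(bracket S (almostTangentField (extT ξ)) w - almostTangent w (bracket S (extT ξ) w))

/-- `ξ ∈ T_w TM` is horizontal: `ξ ∈ ker (Γ_S - I)`. -/
def IsHorizontal (S : (w : TangentBundle 𝓘(ℝ, E) M) → TTangent w)
    {w : TangentBundle 𝓘(ℝ, E) M} (ξ : TTangent w) : Prop :=
  canonicalConnection S w ξ = ξ

/-- The horizontal lift at `w` of `u ∈ T_{π(w)} M`: the unique horizontal `ξ ∈ T_w TM` with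
`dπ(ξ) = u`. -/
def hlift (S : (w : TangentBundle 𝓘(ℝ, E) M) → TTangent w)
    (w : TangentBundle 𝓘(ℝ, E) M) (u : TangentSpace 𝓘(ℝ, E) w.1) : TTangent w :=
  Classical.epsilon fun ξ : TTangent w => IsHorizontal S ξ ∧ dproj w ξ = u

/-! ### Velocities and geodesics -/

/-- The velocity at time `t` of a curve `γ` defined on the interval `J` (one-sided at endpoints of
`J` that belong to `J`). -/
def velocity (γ : ℝ → M) (J : Set ℝ) (t : ℝ) : TangentSpace 𝓘(ℝ, E) (γ t) :=
  mfderivWithin 𝓘(ℝ, ℝ) 𝓘(ℝ, E) γ J t (1 : ℝ)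

/-- `γ` is a geodesic of `S` on the interval `J`: its velocity curve `t ↦ γ̇(t)` lies in `TM \ 0`
and is an integral curve of `S`. -/
def IsGeodesicOn (S : (w : TangentBundle 𝓘(ℝ, E) M) → TTangent w) (γ : ℝ → M)
    (J : Set ℝ) : Prop :=
  (∀ t ∈ J, velocity (E := E) γ J t ≠ 0) ∧
    IsMIntegralCurveOn (I := 𝓘(ℝ, E).tangent)
      (fun t => (⟨γ t, velocity γ J t⟩ : TangentBundle 𝓘(ℝ, E) M)) S J

/-! ### Linear connections on the vertical tangent bundle -/

/-- `Y` is a smooth vertical vector field on `O`, i.e. a smooth section over `O` of the vertical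
tangent bundle. -/
structure IsVerticalFieldOn (Y : (w : TangentBundle 𝓘(ℝ, E) M) → TTangent w)
    (O : Set (TangentBundle 𝓘(ℝ, E) M)) : Prop where
  smooth : SmoothTFieldOn Y O
  vertical : ∀ w ∈ O, IsVertical (Y w)

variable (E M) in
/-- A (smooth) linear connection `∇` on the vertical tangent bundle `VTM → TM \ 0`;
`cov Y w ξ` is the covariant derivative `∇_ξ Y` for `ξ ∈ T_w TM` and a vertical field `Y` that is
smooth near `w ∈ TM \ 0` (all other values of `cov` are irrelevant). -/
structure VerticalConnection where
  cov : ((w : TangentBundle 𝓘(ℝ, E) M) → TTangent w) →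
    (w : TangentBundle 𝓘(ℝ, E) M) → TTangent w →L[ℝ] TTangent w
  add : ∀ O : Set (TangentBundle 𝓘(ℝ, E) M), IsOpen O → O ⊆ slit E M →
    ∀ Y Z : (w : TangentBundle 𝓘(ℝ, E) M) → TTangent w,
      IsVerticalFieldOn Y O → IsVerticalFieldOn Z O →
      ∀ w ∈ O, ∀ ξ : TTangent w, cov (fun z => Y z + Z z) w ξ = cov Y w ξ + cov Z w ξ
  leibniz : ∀ O : Set (TangentBundle 𝓘(ℝ, E) M), IsOpen O → O ⊆ slit E M →
    ∀ (f : TangentBundle 𝓘(ℝ, E) M → ℝ) (Y : (w : TangentBundle 𝓘(ℝ, E) M) → TTangent w),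
      ContMDiffOn 𝓘(ℝ, E).tangent 𝓘(ℝ, ℝ) ∞ f O → IsVerticalFieldOn Y O →
      ∀ w ∈ O, ∀ ξ : TTangent w, cov (fun z => f z • Y z) w ξ =
        (show ℝ from mfderiv 𝓘(ℝ, E).tangent 𝓘(ℝ, ℝ) f w ξ) • Y w + f w • cov Y w ξ
  smooth : ∀ O : Set (TangentBundle 𝓘(ℝ, E) M), IsOpen O → O ⊆ slit E M →
    ∀ X Y : (w : TangentBundle 𝓘(ℝ, E) M) → TTangent w,
      SmoothTFieldOn X O → IsVerticalFieldOn Y O →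
      IsVerticalFieldOn (fun w => cov Y w (X w)) O

namespace VerticalConnection

/-- `∇` is almost-projectable: `∇_ξ C = ξ` for all vertical `ξ`. -/
def IsAlmostProjectable (D : VerticalConnection E M) : Prop :=
  ∀ w ∈ slit E M, ∀ ξ : TTangent w, IsVertical ξ → D.cov canonicalField w ξ = ξ

/-- `∇` is a lift of `Γ_S`: it is almost-projectable and the kernel of `ξ ↦ ∇_ξ C` is the
horizontal distribution of `Γ_S`. -/
def IsLift (D : VerticalConnection E M)
    (S : (w : TangentBundle 𝓘(ℝ, E) M) → TTangent w) : Prop :=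
  D.IsAlmostProjectable ∧
    ∀ w ∈ slit E M, ∀ ξ : TTangent w, D.cov canonicalField w ξ = 0 ↔ IsHorizontal S ξ

/-- The torsion `T(X, Y) = ∇_X J(Y) - ∇_Y J(X) - J[X, Y]`. -/
def torsion (D : VerticalConnection E M)
    (X Y : (w : TangentBundle 𝓘(ℝ, E) M) → TTangent w)
    (w : TangentBundle 𝓘(ℝ, E) M) : TTangent w :=
  D.cov (almostTangentField Y) w (X w) - D.cov (almostTangentField X) w (Y w)
    - almostTangent w (bracket X Y w)

/-- Condition **(T1)**: `T(S, Y) = 0` for all `Y`. -/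
def CondT1 (D : VerticalConnection E M)
    (S : (w : TangentBundle 𝓘(ℝ, E) M) → TTangent w) : Prop :=
  ∀ O : Set (TangentBundle 𝓘(ℝ, E) M), IsOpen O → O ⊆ slit E M →
    ∀ Y : (w : TangentBundle 𝓘(ℝ, E) M) → TTangent w, SmoothTFieldOn Y O →
      ∀ w ∈ O, D.torsion S Y w = 0

/-- The curvature `R(X, Y) Z = ∇_{[X, Y]} Z - [∇_X, ∇_Y] Z` (`Z` vertical). -/
def curvature (D : VerticalConnection E M)
    (X Y Z : (w : TangentBundle 𝓘(ℝ, E) M) → TTangent w)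
    (w : TangentBundle 𝓘(ℝ, E) M) : TTangent w :=
  D.cov Z w (bracket X Y w)
    - (D.cov (fun z => D.cov Z z (Y z)) w (X w) - D.cov (fun z => D.cov Z z (X z)) w (Y w))

/-- The curvature endomorphism `R_w(u) = i_w⁻¹ R(S, u^h) C` in the direction `w`. -/
def curvatureEndo (D : VerticalConnection E M)
    (S : (w : TangentBundle 𝓘(ℝ, E) M) → TTangent w)
    (w : TangentBundle 𝓘(ℝ, E) M) (u : TangentSpace 𝓘(ℝ, E) w.1) :
    TangentSpace 𝓘(ℝ, E) w.1 :=
  vliftInv w (D.curvature S (extT (hlift S w u)) canonicalField w)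

/-! ### The associated family of affine connections -/

/-- `D^w_u V = i_w⁻¹ ∇_{u^h} V^v`, where `u^h` is the horizontal lift of `u` at `w`. -/
def affine (D : VerticalConnection E M)
    (S : (w : TangentBundle 𝓘(ℝ, E) M) → TTangent w)
    (w : TangentBundle 𝓘(ℝ, E) M) (u : TangentSpace 𝓘(ℝ, E) w.1)
    (V : (x : M) → TangentSpace 𝓘(ℝ, E) x) : TangentSpace 𝓘(ℝ, E) w.1 :=
  vliftInv w (D.cov (vliftField V) w (hlift S w u))

/-- The affine connection `D^W_U V` determined by a nowhere null vector field `W`. -/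
def affineField (D : VerticalConnection E M)
    (S : (w : TangentBundle 𝓘(ℝ, E) M) → TTangent w)
    (W U V : (x : M) → TangentSpace 𝓘(ℝ, E) x) (x : M) : TangentSpace 𝓘(ℝ, E) x :=
  D.affine S ⟨x, W x⟩ (U x) V

/-- The covariant derivative `D^W V / dt` at time `t` along a curve `γ : J → M`, where `W` and `V`
are vector fields along `γ`, `W` nowhere null. With `w = W t`, it is the covariant derivative
induced by `D^w`: writing `V τ = ∑ᵢ Vⁱ(τ) Eᵢ(γ τ)` near `τ = t`, for the frame `(Eᵢ)` of
coordinate fields around `γ t`, it equals `∑ᵢ (Vⁱ)'(t) Eᵢ + ∑ᵢ Vⁱ(t) D^w_{γ̇(t)} Eᵢ`. The first sum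
is the first term below; the second sum is `D^w_{γ̇(t)}` of the field `∑ᵢ Vⁱ(t) Eᵢ`, which is
`extM (V t)`. -/
def covAlong (D : VerticalConnection E M)
    (S : (w : TangentBundle 𝓘(ℝ, E) M) → TTangent w) (γ : ℝ → M) (J : Set ℝ)
    (W V : (t : ℝ) → TangentSpace 𝓘(ℝ, E) (γ t)) (t : ℝ) : TangentSpace 𝓘(ℝ, E) (γ t) :=
  (trivializationAt E (TangentSpace 𝓘(ℝ, E)) (γ t)).symm (γ t)
      (derivWithin (fun τ => (trivializationAt E (TangentSpace 𝓘(ℝ, E)) (γ t)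
        (⟨γ τ, V τ⟩ : TangentBundle 𝓘(ℝ, E) M)).2) J t)
    + D.affine S ⟨γ t, W t⟩ (velocity γ J t) (extM (V t))

end VerticalConnection

/-! ### Variations -/

/-- The coordinate field `T = ∂H/∂t` along `H : (-ε, ε) × J → M`. -/
def fieldT (H : ℝ → ℝ → M) (J : Set ℝ) (s t : ℝ) : TangentSpace 𝓘(ℝ, E) (H s t) :=
  velocity (fun τ => H s τ) J t

/-- The coordinate field `U = ∂H/∂s` along `H : (-ε, ε) × J → M`. -/
def fieldU (H : ℝ → ℝ → M) (ε : ℝ) (s t : ℝ) : TangentSpace 𝓘(ℝ, E) (H s t) :=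
  velocity (fun σ => H σ t) (Ioo (-ε) ε) s

/-- `D^T V / dt` for a vector field `V` along `H`: the covariant derivative along
`t ↦ H(s, t)` corresponding to `T`. -/
def covDt (D : VerticalConnection E M)
    (S : (w : TangentBundle 𝓘(ℝ, E) M) → TTangent w) (H : ℝ → ℝ → M) (J : Set ℝ)
    (V : (s t : ℝ) → TangentSpace 𝓘(ℝ, E) (H s t)) (s t : ℝ) :
    TangentSpace 𝓘(ℝ, E) (H s t) :=
  D.covAlong S (fun τ => H s τ) J (fun τ => fieldT H J s τ) (fun τ => V s τ) t

/-- `D^T V / ds` for a vector field `V` along `H`: the covariant derivative along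
`s ↦ H(s, t)` corresponding to `T`. -/
def covDs (D : VerticalConnection E M)
    (S : (w : TangentBundle 𝓘(ℝ, E) M) → TTangent w) (H : ℝ → ℝ → M) (ε : ℝ) (J : Set ℝ)
    (V : (s t : ℝ) → TangentSpace 𝓘(ℝ, E) (H s t)) (s t : ℝ) :
    TangentSpace 𝓘(ℝ, E) (H s t) :=
  D.covAlong S (fun σ => H σ t) (Ioo (-ε) ε) (fun σ => fieldT H J σ t) (fun σ => V σ t) s

/-- `H : (-ε, ε) × J → M` is a smooth variation through regular curves. -/
structure IsRegularVariation (E : Type*) [NormedAddCommGroup E] [NormedSpace ℝ E]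
    {M : Type*} [TopologicalSpace M] [ChartedSpace E M] [IsManifold 𝓘(ℝ, E) ∞ M]
    (H : ℝ → ℝ → M) (ε : ℝ) (J : Set ℝ) : Prop where
  smooth : ContMDiffOn 𝓘(ℝ, ℝ × ℝ) 𝓘(ℝ, E) ∞ (fun p : ℝ × ℝ => H p.1 p.2) (Ioo (-ε) ε ×ˢ J)
  regular : ∀ s ∈ Ioo (-ε) ε, ∀ t ∈ J, fieldT (E := E) H J s t ≠ 0

end

end SprayGeometry

end

/-! Everything is a computation in the chart (x, y) of TM induced by a chart of M. There S = (y,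
f(x, y)). For ξ = (a, b), almost-projectability gives ∇_ξ C = b + N(x, y)a with N linear in a
(`nonlinear`), so ξ is horizontal iff b = -Na. For a vertical field Y, ∇_ξ Y = dY(ξ) + G(ξ)Y with a
Christoffel term G (`tcoords_cov`).

The proof needs only three facts about G and never differentiates it. They are G(ξ)y = Na
(`christoffel_canonicalField`), G(S)v = Nv, which is the content of (T1) (`christoffel_spray`), and
G(ξ)0 = 0 (`christoffel_zero`). About the spray, Γ_S(a, b) = (a, f_y a - b), hence f_y = -2N
(`fderiv_sprayCoeff_vertical`). Homogeneity gives f_y y = 2f, hence S is horizontal, f = -Ny, and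
S(w) is the horizontal lift of w at w.

Let h be the variation H read in the chart. The derivative D^T/dt goes in the direction T, whose
horizontal lift at T is S, so G acts there as N. In D^T T/ds the term G is applied to T itself,
which gives N h_s. The outer D^T/ds is applied to D^T T/dt, which vanishes at (0, t) because λ is a
geodesic, so G drops out. With D^T T/dt = h_tt - f and D^T T/ds = h_st + N h_s, the third
derivatives cancel by symmetry, leaving -df(h_s, h_st) - dN(h_t, f)h_s - N h_st - N(h_st + N h_s).
On the other side, ∇_S C = 0 gives R_w(u) = -df(u, -Nu) + NNu - dN(y, f)u. The relation f_y = -2N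
replaces -Nu by any second component (`coords_curvatureEndo_eq`), and the choice h_st identifies the
two expressions.

For (2), D^T T/dt vanishes identically, and D^T U/dt = D^T T/ds since h_st = h_ts. Claim (3) is the
same computation with W in place of T; the terms containing a derivative of U are absorbed by the
bracket. -/

open scoped Topology

namespace SprayGeometry

/-! ### Tangent vectors, vector fields and Lie brackets in a chart -/

section Coordinates

variable {F : Type*} [NormedAddCommGroup F] [NormedSpace ℝ F]
  {H : Type*} [TopologicalSpace H] {I : ModelWithCorners ℝ F H}
  {N : Type*} [TopologicalSpace N] [ChartedSpace H N]

variable (I) in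
/-- The coordinates of a tangent vector at `x` in the preferred chart at `p`. -/
noncomputable def coords (p x : N) : TangentSpace I x →L[ℝ] F :=
  mfderiv I 𝓘(ℝ, F) (extChartAt I p) x

variable (I) in
/-- The representation of a vector field in the preferred chart at `p`. -/
noncomputable def fieldCoords (p : N) (X : (x : N) → TangentSpace I x) (z : F) : F :=
  coords I p ((extChartAt I p).symm z) (X ((extChartAt I p).symm z))

lemma fieldCoords_extChartAt {p x : N} (hx : x ∈ (extChartAt I p).source)
    (X : (x : N) → TangentSpace I x) :
    fieldCoords I p X (extChartAt I p x) = coords I p x (X x) := by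
  simp only [fieldCoords]
  rw [(extChartAt I p).left_inv hx]

variable [IsManifold I ∞ N]

lemma coords_eq_trivializationAt {p x : N} (hx : x ∈ (extChartAt I p).source)
    (v : TangentSpace I x) :
    coords I p x v = (trivializationAt F (TangentSpace I) p ⟨x, v⟩).2 := by
  rw [extChartAt_source] at hx
  have := TangentBundle.continuousLinearMapAt_trivializationAt (I := I) hx
  rw [coords, ← this]
  rw [Bundle.Trivialization.continuousLinearMapAt_apply, Bundle.Trivialization.linearMapAt_apply,
    if_pos (by simpa using hx)]

lemma coords_injective {p x : N} (hx : x ∈ (extChartAt I p).source) :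
    Function.Injective (coords I p x) := by
  obtain ⟨e, he⟩ := isInvertible_mfderiv_extChartAt hx
  rw [coords, ← he]
  exact e.injective

lemma coords_surjective {p x : N} (hx : x ∈ (extChartAt I p).source) :
    Function.Surjective (coords I p x) := by
  obtain ⟨e, he⟩ := isInvertible_mfderiv_extChartAt hx
  rw [coords, ← he]
  exact e.surjective

lemma coords_trivializationAt_symm {p x : N} (hx : x ∈ (extChartAt I p).source) (v : F) :
    coords I p x ((trivializationAt F (TangentSpace I) p).symm x v) = v := by
  rw [coords_eq_trivializationAt hx, Bundle.Trivialization.mk_symm]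
  · rw [Bundle.Trivialization.apply_symm_apply]
    rw [extChartAt_source] at hx
    simpa [Bundle.Trivialization.mem_target] using hx
  · simpa using hx

lemma coords_self (p : N) (v : TangentSpace I p) : coords I p p v = v := by
  rw [coords, mfderiv_extChartAt_self]
  rfl

lemma coords_extend {p x : N} (hx : x ∈ (extChartAt I p).source) (v : TangentSpace I p) :
    coords I p x (FiberBundle.extend F v x) = v := by
  rw [FiberBundle.extend, coords_trivializationAt_symm hx,
    ← coords_eq_trivializationAt (mem_extChartAt_source p), coords_self]

lemma contMDiffOn_section_iff_fieldCoords [I.Boundaryless] {p : N}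
    {X : (x : N) → TangentSpace I x} {O : Set N}
    (hO : IsOpen O) (hOp : O ⊆ (extChartAt I p).source) :
    ContMDiffOn I I.tangent ∞ (fun x => (⟨x, X x⟩ : TangentBundle I N)) O ↔
      ContDiffOn ℝ ∞ (fieldCoords I p X)
        ((extChartAt I p).target ∩ (extChartAt I p).symm ⁻¹' O) := by
  have h1 := (trivializationAt F (TangentSpace I) p).contMDiffOn_section_iff (IB := I) (n := ∞)
    (s := X) hO (by simpa [extChartAt_source] using hOp)
  refine h1.trans ?_
  have h2 : ∀ x ∈ O, (trivializationAt F (TangentSpace I) p ⟨x, X x⟩).2 =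
      (fieldCoords I p X ∘ extChartAt I p) x := by
    intro x hx
    rw [← coords_eq_trivializationAt (hOp hx), Function.comp, fieldCoords_extChartAt (hOp hx)]
  rw [contMDiffOn_congr h2, ← contMDiffOn_iff_contDiffOn]
  constructor
  · intro h
    have h3 := h.comp ((contMDiffOn_extChartAt_symm p).mono inter_subset_left)
      (s := (extChartAt I p).target ∩ (extChartAt I p).symm ⁻¹' O) (fun z hz => hz.2)
    refine h3.congr fun z hz => ?_
    simp only [Function.comp, (extChartAt I p).right_inv hz.1]
  · intro h
    refine h.comp ((contMDiffOn_extChartAt (x := p)).mono ?_) fun x hx => ?_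
    · rwa [← extChartAt_source I]
    · refine ⟨(extChartAt I p).map_source (hOp hx), ?_⟩
      rwa [mem_preimage, (extChartAt I p).left_inv (hOp hx)]

omit [IsManifold I ∞ N] in
lemma isOpen_target_inter_preimage [I.Boundaryless] (p : N) {O : Set N} (hO : IsOpen O) :
    IsOpen ((extChartAt I p).target ∩ (extChartAt I p).symm ⁻¹' O) :=
  (continuousOn_extChartAt_symm p).isOpen_inter_preimage (isOpen_extChartAt_target p) hO

lemma contMDiffOn_comp_extChartAt {G : Type*} [NormedAddCommGroup G] [NormedSpace ℝ G]
    {p : N} {g : F → G} {O : Set N} (hOp : O ⊆ (extChartAt I p).source)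
    (hg : ContDiffOn ℝ ∞ g ((extChartAt I p).target ∩ (extChartAt I p).symm ⁻¹' O)) :
    ContMDiffOn I 𝓘(ℝ, G) ∞ (fun x => g (extChartAt I p x)) O := by
  rw [← contMDiffOn_iff_contDiffOn] at hg
  refine hg.comp ((contMDiffOn_extChartAt (x := p)).mono ?_) fun x hx => ?_
  · rwa [← extChartAt_source I]
  · refine ⟨(extChartAt I p).map_source (hOp hx), ?_⟩
    rwa [mem_preimage, (extChartAt I p).left_inv (hOp hx)]

lemma mfderiv_comp_extChartAt_apply {G : Type*} [NormedAddCommGroup G] [NormedSpace ℝ G]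
    {p x : N} (hx : x ∈ (extChartAt I p).source) {g : F → G}
    (hg : DifferentiableAt ℝ g (extChartAt I p x)) (ξ : TangentSpace I x) :
    mfderiv I 𝓘(ℝ, G) (fun x => g (extChartAt I p x)) x ξ =
      fderiv ℝ g (extChartAt I p x) (coords I p x ξ) := by
  have h1 : MDifferentiableAt I 𝓘(ℝ, F) (extChartAt I p) x :=
    mdifferentiableAt_extChartAt (by rwa [← extChartAt_source I])
  have := mfderiv_comp x (I' := 𝓘(ℝ, F)) (g := g) hg.mdifferentiableAt h1
  change mfderiv I 𝓘(ℝ, G) (g ∘ extChartAt I p) x ξ = _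
  rw [this, mfderiv_eq_fderiv]
  rfl

lemma HasMFDerivWithinAt.hasDerivWithinAt_extChartAt {γ : ℝ → N} {J : Set ℝ} {t : ℝ}
    {L : ℝ →L[ℝ] TangentSpace I (γ t)} (h : HasMFDerivWithinAt 𝓘(ℝ, ℝ) I γ J t L) {p : N}
    (hp : γ t ∈ (extChartAt I p).source) :
    HasDerivWithinAt (fun τ => extChartAt I p (γ τ)) (coords I p (γ t) (L 1)) J t := by
  have h1 : MDifferentiableAt I 𝓘(ℝ, F) (extChartAt I p) (γ t) :=
    mdifferentiableAt_extChartAt (by rwa [← extChartAt_source I])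
  have h2 : HasFDerivWithinAt (fun τ => extChartAt I p (γ τ))
      ((coords I p (γ t)).comp L : ℝ →L[ℝ] F) J t :=
    (h1.hasMFDerivAt.comp_hasMFDerivWithinAt t h).hasFDerivWithinAt
  exact h2.hasDerivWithinAt

/-- Brackets commute with pullback along the inverse chart, and the pullback of a field is its chart
representation. The bracket thus becomes the vector-space one, DY(X) - DX(Y). -/
lemma coords_mlieBracket [I.Boundaryless] [CompleteSpace F] {p x : N}
    (hx : x ∈ (extChartAt I p).source) {X Y : (x : N) → TangentSpace I x} {O : Set N}
    (hO : IsOpen O) (hxO : x ∈ O)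
    (hX : ContMDiffOn I I.tangent ∞ (fun x => (⟨x, X x⟩ : TangentBundle I N)) O)
    (hY : ContMDiffOn I I.tangent ∞ (fun x => (⟨x, Y x⟩ : TangentBundle I N)) O) :
    coords I p x (VectorField.mlieBracket I X Y x) =
      fderiv ℝ (fieldCoords I p Y) (extChartAt I p x) (fieldCoords I p X (extChartAt I p x)) -
      fderiv ℝ (fieldCoords I p X) (extChartAt I p x) (fieldCoords I p Y (extChartAt I p x)) := by
  have : IsManifold I (minSmoothness ℝ 3) N :=
    IsManifold.of_le (n := ∞) (by simpa using ENat.LEInfty.out)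
  -- Pulling back applies the inverse of the derivative of the inverse chart, and this is the
  -- derivative of the chart, i.e. `coords`.
  have hinv : ∀ V : (x : N) → TangentSpace I x, ∀ z ∈ (extChartAt I p).target,
      VectorField.mpullback 𝓘(ℝ, F) I (extChartAt I p).symm V z = fieldCoords I p V z := by
    intro V z hz
    have h1 := mfderiv_extChartAt_comp_mfderivWithin_extChartAt_symm hz
    have h2 := mfderivWithin_extChartAt_symm_comp_mfderiv_extChartAt hz
    rw [I.range_eq_univ, mfderivWithin_univ] at h1 h2
    rw [VectorField.mpullback_apply, ContinuousLinearMap.inverse_eq h2 h1]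
    rfl
  have hz := (extChartAt I p).map_source hx
  have hxx := (extChartAt I p).left_inv hx
  have hd : ∀ V : (x : N) → TangentSpace I x,
      ContMDiffOn I I.tangent ∞ (fun x => (⟨x, V x⟩ : TangentBundle I N)) O →
      MDifferentiableAt I I.tangent (fun x => (⟨x, V x⟩ : TangentBundle I N))
        ((extChartAt I p).symm (extChartAt I p x)) := by
    intro V hV
    rw [hxx]
    exact (hV.contMDiffAt (hO.mem_nhds hxO)).mdifferentiableAt (by simp)
  have hs : ContMDiffAt 𝓘(ℝ, F) I ∞ (extChartAt I p).symm (extChartAt I p x) :=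
    (contMDiffOn_extChartAt_symm p).contMDiffAt ((isOpen_extChartAt_target p).mem_nhds hz)
  have key := VectorField.mpullback_mlieBracket (hd X hX) (hd Y hY) hs
    (by simpa using ENat.LEInfty.out)
  rw [hinv _ _ hz, fieldCoords_extChartAt hx] at key
  rw [key]
  have hev : ∀ V : (x : N) → TangentSpace I x,
      VectorField.mpullback 𝓘(ℝ, F) I (extChartAt I p).symm V =ᶠ[𝓝 (extChartAt I p x)]
        fieldCoords I p V := fun V => by
    filter_upwards [(isOpen_extChartAt_target p).mem_nhds hz] with z hz using hinv V z hz
  rw [Filter.EventuallyEq.mlieBracket_vectorField_eq (hev X) (hev Y)]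
  exact congrFun (VectorField.mlieBracketWithin_univ.symm.trans
    (VectorField.mlieBracketWithin_eq_lieBracketWithin.trans
      VectorField.lieBracketWithin_univ)) _

end Coordinates

/-! ### The induced charts of TM -/

section BundleCoordinates

variable {E : Type*} [NormedAddCommGroup E] [NormedSpace ℝ E]
  {M : Type*} [TopologicalSpace M] [ChartedSpace E M] [IsManifold 𝓘(ℝ, E) ∞ M]

variable (E) in
/-- The chart of `TM` induced by the preferred chart of `M` at `p`. -/
noncomputable def bundleChart (p : M) : PartialEquiv (TangentBundle 𝓘(ℝ, E) M) (E × E) :=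
  extChartAt 𝓘(ℝ, E).tangent (⟨p, 0⟩ : TangentBundle 𝓘(ℝ, E) M)

/-- The coordinates of a vector tangent to `TM` in the chart of `TM` induced by the preferred
chart of `M` at `p`. -/
noncomputable def tcoords (p : M) (w : TangentBundle 𝓘(ℝ, E) M) : TTangent w →L[ℝ] E × E :=
  coords 𝓘(ℝ, E).tangent (⟨p, 0⟩ : TangentBundle 𝓘(ℝ, E) M) w

/-- The representation of a vector field on `TM` in the chart of `TM` induced by the preferred
chart of `M` at `p`. -/
noncomputable def tfieldCoords (p : M) (X : (w : TangentBundle 𝓘(ℝ, E) M) → TTangent w) :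
    E × E → E × E :=
  fieldCoords 𝓘(ℝ, E).tangent (⟨p, 0⟩ : TangentBundle 𝓘(ℝ, E) M) X

/-- The preferred chart of TM at a vector depends only on the base point. Charts of TM can therefore
be indexed by points of M, and the extension `extT` of a vector at `w` is constant in `bundleChart E
w.1`. -/
lemma extChartAt_tangentBundle (w : TangentBundle 𝓘(ℝ, E) M) :
    extChartAt 𝓘(ℝ, E).tangent w = bundleChart E w.1 := by
  rw [bundleChart, ModelWithCorners.tangent, FiberBundle.extChartAt, FiberBundle.extChartAt]

lemma mem_bundleChart_source {p : M} {w : TangentBundle 𝓘(ℝ, E) M} :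
    w ∈ (bundleChart E p).source ↔ w.1 ∈ (extChartAt 𝓘(ℝ, E) p).source := by
  rw [bundleChart, extChartAt_source, extChartAt_source, TangentBundle.mem_chart_source_iff]

lemma bundleChart_apply {p : M} {w : TangentBundle 𝓘(ℝ, E) M}
    (hw : w.1 ∈ (extChartAt 𝓘(ℝ, E) p).source) :
    bundleChart E p w = (extChartAt 𝓘(ℝ, E) p w.1, coords 𝓘(ℝ, E) p w.1 w.2) := by
  rw [coords_eq_trivializationAt hw, bundleChart, ModelWithCorners.tangent,
    FiberBundle.extChartAt]
  rfl

lemma bundleChart_target (p : M) :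
    (bundleChart E p).target = (extChartAt 𝓘(ℝ, E) p).target ×ˢ (univ : Set E) := by
  rw [bundleChart, ModelWithCorners.tangent, FiberBundle.extChartAt_target]
  congr 1
  refine inter_eq_left.2 fun z hz => ?_
  have := (extChartAt 𝓘(ℝ, E) p).map_target hz
  rw [extChartAt_source] at this
  simpa using this

lemma bundleChart_symm_fst {p : M} {z : E × E} (hz : z ∈ (bundleChart E p).target) :
    ((bundleChart E p).symm z).1 = (extChartAt 𝓘(ℝ, E) p).symm z.1 := by
  have h1 := (bundleChart E p).right_inv hz
  have h2 := mem_bundleChart_source.1 ((bundleChart E p).map_target hz)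
  rw [bundleChart_apply h2] at h1
  exact ((extChartAt 𝓘(ℝ, E) p).left_inv h2).symm.trans
    (congrArg (fun y => (extChartAt 𝓘(ℝ, E) p).symm y.1) h1)

lemma coords_bundleChart_symm_snd {p : M} {z : E × E} (hz : z ∈ (bundleChart E p).target) :
    coords 𝓘(ℝ, E) p ((bundleChart E p).symm z).1 ((bundleChart E p).symm z).2 = z.2 := by
  have h1 := (bundleChart E p).right_inv hz
  have h2 := mem_bundleChart_source.1 ((bundleChart E p).map_target hz)
  rw [bundleChart_apply h2] at h1
  exact congrArg Prod.snd h1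

lemma isOpen_bundleChart_target (p : M) : IsOpen (bundleChart E p).target :=
  isOpen_extChartAt_target _

lemma isOpen_bundleChart_source (p : M) : IsOpen (bundleChart E p).source :=
  isOpen_extChartAt_source _

lemma tcoords_injective {p : M} {w : TangentBundle 𝓘(ℝ, E) M}
    (hw : w.1 ∈ (extChartAt 𝓘(ℝ, E) p).source) : Function.Injective (tcoords p w) :=
  coords_injective (mem_bundleChart_source.2 hw)

lemma tfieldCoords_bundleChart {p : M} {w : TangentBundle 𝓘(ℝ, E) M}
    (hw : w.1 ∈ (extChartAt 𝓘(ℝ, E) p).source)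
    (X : (w : TangentBundle 𝓘(ℝ, E) M) → TTangent w) :
    tfieldCoords p X (bundleChart E p w) = tcoords p w (X w) :=
  fieldCoords_extChartAt (mem_bundleChart_source.2 hw) X

lemma tcoords_self (w : TangentBundle 𝓘(ℝ, E) M) (ξ : TTangent w) : tcoords w.1 w ξ = ξ := by
  have h1 := coords_self w ξ
  have h2 : coords 𝓘(ℝ, E).tangent w w = tcoords w.1 w := by
    rw [tcoords, coords, coords, extChartAt_tangentBundle, extChartAt_tangentBundle]
  rw [← h2, h1]

lemma tcoords_extT {w z : TangentBundle 𝓘(ℝ, E) M} (hz : z.1 ∈ (extChartAt 𝓘(ℝ, E) w.1).source)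
    (ξ : TTangent w) : tcoords w.1 z (extT ξ z) = ξ := by
  have h1 : coords 𝓘(ℝ, E).tangent w z = tcoords w.1 z := by
    rw [tcoords, coords, coords, extChartAt_tangentBundle, extChartAt_tangentBundle]
  rw [← h1]
  refine coords_extend ?_ ξ
  rw [extChartAt_tangentBundle]
  exact mem_bundleChart_source.2 hz

lemma tcoords_fst {p : M} {w : TangentBundle 𝓘(ℝ, E) M}
    (hw : w.1 ∈ (extChartAt 𝓘(ℝ, E) p).source) (ξ : TTangent w) :
    (tcoords p w ξ).1 = coords 𝓘(ℝ, E) p w.1 (dproj w ξ) := by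
  have hp : MDifferentiableAt 𝓘(ℝ, E).tangent 𝓘(ℝ, E)
      (fun z : TangentBundle 𝓘(ℝ, E) M => z.1) w :=
    (Bundle.contMDiffAt_proj (n := 1) (TangentSpace 𝓘(ℝ, E))).mdifferentiableAt one_ne_zero
  have hφ : MDifferentiableAt 𝓘(ℝ, E) 𝓘(ℝ, E) (extChartAt 𝓘(ℝ, E) p) w.1 :=
    mdifferentiableAt_extChartAt (by rwa [← extChartAt_source 𝓘(ℝ, E)])
  have h1 := mfderiv_comp w hφ hp
  have h2 := mfderiv_comp_extChartAt_apply (I := 𝓘(ℝ, E).tangent)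
    (mem_bundleChart_source.2 hw) (g := Prod.fst) differentiableAt_fst ξ
  have h3 : (fun z => ((extChartAt 𝓘(ℝ, E).tangent (⟨p, 0⟩ : TangentBundle 𝓘(ℝ, E) M)) z).1)
      =ᶠ[𝓝 w] (extChartAt 𝓘(ℝ, E) p) ∘ (fun z : TangentBundle 𝓘(ℝ, E) M => z.1) := by
    filter_upwards [(isOpen_bundleChart_source p).mem_nhds (mem_bundleChart_source.2 hw)]
      with z hz
    exact congrArg Prod.fst (bundleChart_apply (mem_bundleChart_source.1 hz))
  rw [h3.mfderiv_eq, h1, fderiv_fst] at h2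
  exact h2.symm

/-- In the bundle chart the curve w + tu is an affine line in the fibre, with constant velocity (0,
u). -/
lemma tcoords_vlift {p : M} {w : TangentBundle 𝓘(ℝ, E) M}
    (hw : w.1 ∈ (extChartAt 𝓘(ℝ, E) p).source) (u : TangentSpace 𝓘(ℝ, E) w.1) :
    tcoords p w (vlift w u) = (0, coords 𝓘(ℝ, E) p w.1 u) := by
  set c : ℝ → TangentBundle 𝓘(ℝ, E) M := fun t => ⟨w.1, w.2 + t • u⟩ with hc
  have hcs : ∀ t, c t ∈ (bundleChart E p).source := fun t => mem_bundleChart_source.2 hw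
  have hcc : ∀ t, bundleChart E p (c t) =
      (extChartAt 𝓘(ℝ, E) p w.1, coords 𝓘(ℝ, E) p w.1 w.2 + t • coords 𝓘(ℝ, E) p w.1 u) := by
    intro t
    rw [bundleChart_apply (mem_bundleChart_source.1 (hcs t))]
    have h1 : coords 𝓘(ℝ, E) p w.1 (w.2 + t • u) =
        coords 𝓘(ℝ, E) p w.1 w.2 + t • coords 𝓘(ℝ, E) p w.1 u := by
      rw [map_add, map_smul]
    exact Prod.ext rfl h1
  have hd : HasDerivAt (fun t => bundleChart E p (c t)) (0, coords 𝓘(ℝ, E) p w.1 u) 0 := by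
    simp only [hcc]
    refine (hasDerivAt_const _ _).prodMk ?_
    simpa using! ((hasDerivAt_id (0 : ℝ)).smul_const (coords 𝓘(ℝ, E) p w.1 u)).const_add
      (coords 𝓘(ℝ, E) p w.1 w.2)
  have hm : MDifferentiableAt 𝓘(ℝ, ℝ) 𝓘(ℝ, E).tangent c 0 := by
    have h1 : c = (bundleChart E p).symm ∘ (fun t => bundleChart E p (c t)) := by
      ext1 t
      exact ((bundleChart E p).left_inv (hcs t)).symm
    rw [h1]
    refine MDifferentiableAt.comp (I' := 𝓘(ℝ, E × E)) _ ?_ hd.differentiableAt.mdifferentiableAt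
    exact ((contMDiffOn_extChartAt_symm (n := ∞) (I := 𝓘(ℝ, E).tangent) _).contMDiffAt
      ((isOpen_bundleChart_target p).mem_nhds ((bundleChart E p).map_source
        (hcs 0)))).mdifferentiableAt (by simp)
  have h2 := HasMFDerivWithinAt.hasDerivWithinAt_extChartAt
    (hm.hasMFDerivAt.hasMFDerivWithinAt (s := univ)) (p := ⟨p, 0⟩) (hcs 0)
  -- The curve starts at `w.2 + 0 • u`, which equals `w.2` only propositionally; the coordinate maps
  -- at the two points are identified by transport.
  have h3 : ∀ w', w' = w → ∀ ζ : E × E, (tcoords p w' : E × E →L[ℝ] E × E) ζ = tcoords p w ζ := by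
    rintro _ rfl ζ
    rfl
  exact (h3 (c 0) (by simp [hc]) _).symm.trans
    ((hasDerivWithinAt_univ.1 h2).unique hd)

end BundleCoordinates

/-! ### Vertical vectors, the structural fields and the slit bundle in coordinates -/

section VerticalCoordinates

variable {E : Type*} [NormedAddCommGroup E] [NormedSpace ℝ E]
  {M : Type*} [TopologicalSpace M] [ChartedSpace E M] [IsManifold 𝓘(ℝ, E) ∞ M]

omit [IsManifold 𝓘(ℝ, E) ∞ M] in
lemma mem_chart_base (x : M) : x ∈ (extChartAt 𝓘(ℝ, E) x).source := mem_extChartAt_source x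

lemma isVertical_iff {p : M} {w : TangentBundle 𝓘(ℝ, E) M}
    (hw : w.1 ∈ (extChartAt 𝓘(ℝ, E) p).source) (ξ : TTangent w) :
    IsVertical ξ ↔ (tcoords p w ξ).1 = 0 := by
  rw [tcoords_fst hw, IsVertical]
  exact ⟨fun h => by rw [h, map_zero], fun h => coords_injective hw (by rw [h, map_zero])⟩

/-- `vliftInv` is a `Function.invFun`, meaningful only on the range of `vlift`. That range is all of
the vertical space, because `coords` is onto. -/
lemma vlift_vliftInv {w : TangentBundle 𝓘(ℝ, E) M} {ξ : TTangent w} (h : IsVertical ξ) :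
    vlift w (vliftInv w ξ) = ξ := by
  have hw := mem_chart_base (E := E) w.1
  refine Function.invFun_eq (f := vlift w) ?_
  obtain ⟨u, hu⟩ := coords_surjective hw (tcoords w.1 w ξ).2
  refine ⟨u, tcoords_injective hw ?_⟩
  rw [tcoords_vlift hw, hu, ← (isVertical_iff hw ξ).1 h]

lemma coords_vliftInv {p : M} {w : TangentBundle 𝓘(ℝ, E) M}
    (hw : w.1 ∈ (extChartAt 𝓘(ℝ, E) p).source) {ξ : TTangent w} (h : IsVertical ξ) :
    coords 𝓘(ℝ, E) p w.1 (vliftInv w ξ) = (tcoords p w ξ).2 := by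
  conv_rhs => rw [← vlift_vliftInv h]
  rw [tcoords_vlift hw]

lemma tcoords_almostTangent {p : M} {w : TangentBundle 𝓘(ℝ, E) M}
    (hw : w.1 ∈ (extChartAt 𝓘(ℝ, E) p).source) (ξ : TTangent w) :
    tcoords p w (almostTangent w ξ) = (0, (tcoords p w ξ).1) := by
  rw [almostTangent, tcoords_vlift hw, tcoords_fst hw]

lemma symm_mem_source {p : M} {z : E × E} (hz : z ∈ (bundleChart E p).target) :
    ((bundleChart E p).symm z).1 ∈ (extChartAt 𝓘(ℝ, E) p).source :=
  mem_bundleChart_source.1 ((bundleChart E p).map_target hz)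

lemma tfieldCoords_canonicalField {p : M} {z : E × E} (hz : z ∈ (bundleChart E p).target) :
    tfieldCoords p canonicalField z = (0, z.2) := by
  have h := tcoords_vlift (symm_mem_source hz) ((bundleChart E p).symm z).2
  rw [coords_bundleChart_symm_snd hz] at h
  exact h

lemma tfieldCoords_almostTangentField {p : M} {z : E × E}
    (hz : z ∈ (bundleChart E p).target)
    (X : (w : TangentBundle 𝓘(ℝ, E) M) → TTangent w) :
    tfieldCoords p (almostTangentField X) z = (0, (tfieldCoords p X z).1) :=
  tcoords_almostTangent (symm_mem_source hz) _

lemma tfieldCoords_vliftField {p : M} {z : E × E} (hz : z ∈ (bundleChart E p).target)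
    (V : (x : M) → TangentSpace 𝓘(ℝ, E) x) :
    tfieldCoords p (vliftField V) z = (0, fieldCoords 𝓘(ℝ, E) p V z.1) := by
  have h := tcoords_vlift (symm_mem_source hz) (V ((bundleChart E p).symm z).1)
  refine h.trans ?_
  rw [bundleChart_symm_fst hz]
  rfl

lemma tfieldCoords_extT {w : TangentBundle 𝓘(ℝ, E) M} {z : E × E}
    (hz : z ∈ (bundleChart E w.1).target) (ξ : TTangent w) :
    tfieldCoords w.1 (extT ξ) z = ξ :=
  tcoords_extT (symm_mem_source hz) ξ

lemma fieldCoords_extM {p : M} {z : E} (hz : z ∈ (extChartAt 𝓘(ℝ, E) p).target)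
    (u : TangentSpace 𝓘(ℝ, E) p) :
    fieldCoords 𝓘(ℝ, E) p (extM u) z = u :=
  coords_extend ((extChartAt 𝓘(ℝ, E) p).map_target hz) u

/-- The vector field on `TM` that is constant in the chart induced by the preferred chart
at `p`. -/
noncomputable def constField (p : M) (v : E × E) :
    (w : TangentBundle 𝓘(ℝ, E) M) → TTangent w :=
  extT (w := (⟨p, 0⟩ : TangentBundle 𝓘(ℝ, E) M)) v

lemma tcoords_constField {p : M} {w : TangentBundle 𝓘(ℝ, E) M}
    (hw : w.1 ∈ (extChartAt 𝓘(ℝ, E) p).source) (v : E × E) :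
    tcoords p w (constField p v w) = v :=
  tcoords_extT (w := (⟨p, 0⟩ : TangentBundle 𝓘(ℝ, E) M)) hw v

lemma tfieldCoords_constField {p : M} {z : E × E} (hz : z ∈ (bundleChart E p).target)
    (v : E × E) : tfieldCoords p (constField p v) z = v :=
  tcoords_constField (symm_mem_source hz) v

variable (E) in
/-- The part of the slit tangent bundle over the domain of the preferred chart at `p`. -/
def chartSlit (p : M) : Set (TangentBundle 𝓘(ℝ, E) M) :=
  {w | w.1 ∈ (extChartAt 𝓘(ℝ, E) p).source ∧ w.2 ≠ 0}

variable (E) in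
/-- The image of `chartSlit E p` under the bundle chart at `p`. -/
def slitDomain (p : M) : Set (E × E) := (extChartAt 𝓘(ℝ, E) p).target ×ˢ {0}ᶜ

omit [IsManifold 𝓘(ℝ, E) ∞ M] in
lemma chartSlit_subset_slit (p : M) : chartSlit E p ⊆ slit E M := fun _ hw => hw.2

lemma chartSlit_subset_source (p : M) : chartSlit E p ⊆ (bundleChart E p).source :=
  fun _ hw => mem_bundleChart_source.2 hw.1

lemma slitDomain_subset_target (p : M) : slitDomain E p ⊆ (bundleChart E p).target := by
  rw [bundleChart_target]
  exact prod_mono_right (subset_univ _)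

omit [IsManifold 𝓘(ℝ, E) ∞ M] in
lemma isOpen_slitDomain (p : M) : IsOpen (slitDomain E p) :=
  (isOpen_extChartAt_target p).prod isOpen_compl_singleton

lemma bundleChart_mem_slitDomain {p : M} {w : TangentBundle 𝓘(ℝ, E) M}
    (hw : w ∈ chartSlit E p) : bundleChart E p w ∈ slitDomain E p := by
  rw [bundleChart_apply hw.1]
  refine ⟨(extChartAt 𝓘(ℝ, E) p).map_source hw.1, fun h => hw.2 (coords_injective hw.1 ?_)⟩
  rw [map_zero]
  exact h

lemma symm_mem_chartSlit {p : M} {z : E × E} (hz : z ∈ slitDomain E p) :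
    (bundleChart E p).symm z ∈ chartSlit E p := by
  have hz' := slitDomain_subset_target p hz
  refine ⟨symm_mem_source hz', fun h => hz.2 ?_⟩
  have h1 := coords_bundleChart_symm_snd hz'
  rw [h, map_zero] at h1
  exact h1.symm

lemma target_inter_preimage_chartSlit (p : M) :
    (bundleChart E p).target ∩ (bundleChart E p).symm ⁻¹' chartSlit E p = slitDomain E p := by
  ext z
  refine ⟨fun hz => ?_, fun hz => ⟨slitDomain_subset_target p hz, symm_mem_chartSlit hz⟩⟩
  have := bundleChart_mem_slitDomain hz.2
  rwa [(bundleChart E p).right_inv hz.1] at this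

lemma isOpen_chartSlit (p : M) : IsOpen (chartSlit E p) := by
  have : chartSlit E p = (bundleChart E p).source ∩ bundleChart E p ⁻¹' slitDomain E p := by
    ext w
    refine ⟨fun hw => ⟨chartSlit_subset_source p hw, bundleChart_mem_slitDomain hw⟩,
      fun hw => ?_⟩
    have := symm_mem_chartSlit hw.2
    rwa [(bundleChart E p).left_inv hw.1] at this
  rw [this]
  exact (continuousOn_extChartAt (I := 𝓘(ℝ, E).tangent) _).isOpen_inter_preimage
    (isOpen_bundleChart_source p) (isOpen_slitDomain p)

lemma smoothTFieldOn_iff {p : M} {O : Set (TangentBundle 𝓘(ℝ, E) M)} (hO : IsOpen O)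
    (hOp : O ⊆ (bundleChart E p).source) (X : (w : TangentBundle 𝓘(ℝ, E) M) → TTangent w) :
    SmoothTFieldOn X O ↔ ContDiffOn ℝ ∞ (tfieldCoords p X)
      ((bundleChart E p).target ∩ (bundleChart E p).symm ⁻¹' O) :=
  contMDiffOn_section_iff_fieldCoords hO hOp

lemma isOpen_bundleChart_target_inter (p : M) {O : Set (TangentBundle 𝓘(ℝ, E) M)}
    (hO : IsOpen O) : IsOpen ((bundleChart E p).target ∩ (bundleChart E p).symm ⁻¹' O) :=
  isOpen_target_inter_preimage _ hO

lemma bundleChart_mem_target_inter {p : M} {O : Set (TangentBundle 𝓘(ℝ, E) M)}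
    {w : TangentBundle 𝓘(ℝ, E) M} (hw : w.1 ∈ (extChartAt 𝓘(ℝ, E) p).source) (hwO : w ∈ O) :
    bundleChart E p w ∈ (bundleChart E p).target ∩ (bundleChart E p).symm ⁻¹' O := by
  refine ⟨(bundleChart E p).map_source (mem_bundleChart_source.2 hw), ?_⟩
  rwa [mem_preimage, (bundleChart E p).left_inv (mem_bundleChart_source.2 hw)]

lemma smoothTFieldOn_constField {p : M} {O : Set (TangentBundle 𝓘(ℝ, E) M)} (hO : IsOpen O)
    (hOp : O ⊆ (bundleChart E p).source) (v : E × E) : SmoothTFieldOn (constField p v) O := by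
  rw [smoothTFieldOn_iff hO hOp]
  exact contDiffOn_const.congr fun z hz => tfieldCoords_constField hz.1 v

lemma tcoords_bracket [CompleteSpace E] {p : M} {w : TangentBundle 𝓘(ℝ, E) M}
    (hw : w.1 ∈ (extChartAt 𝓘(ℝ, E) p).source)
    {X Y : (w : TangentBundle 𝓘(ℝ, E) M) → TTangent w} {O : Set (TangentBundle 𝓘(ℝ, E) M)}
    (hO : IsOpen O) (hwO : w ∈ O) (hX : SmoothTFieldOn X O) (hY : SmoothTFieldOn Y O) :
    tcoords p w (bracket X Y w) =
      fderiv ℝ (tfieldCoords p Y) (bundleChart E p w) (tfieldCoords p X (bundleChart E p w)) -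
      fderiv ℝ (tfieldCoords p X) (bundleChart E p w) (tfieldCoords p Y (bundleChart E p w)) :=
  coords_mlieBracket (mem_bundleChart_source.2 hw) hO hwO hX hY

lemma isVerticalFieldOn_iff {p : M} {O : Set (TangentBundle 𝓘(ℝ, E) M)} (hO : IsOpen O)
    (hOp : O ⊆ (bundleChart E p).source) (X : (w : TangentBundle 𝓘(ℝ, E) M) → TTangent w) :
    IsVerticalFieldOn X O ↔
      ContDiffOn ℝ ∞ (tfieldCoords p X)
        ((bundleChart E p).target ∩ (bundleChart E p).symm ⁻¹' O) ∧
      ∀ z ∈ (bundleChart E p).target ∩ (bundleChart E p).symm ⁻¹' O,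
        (tfieldCoords p X z).1 = 0 := by
  rw [← smoothTFieldOn_iff hO hOp]
  constructor
  · rintro ⟨h1, h2⟩
    exact ⟨h1, fun z hz => (isVertical_iff (symm_mem_source hz.1) _).1 (h2 _ hz.2)⟩
  · rintro ⟨h1, h2⟩
    refine ⟨h1, fun w hw => (isVertical_iff (mem_bundleChart_source.1 (hOp hw)) _).2 ?_⟩
    have hw' := mem_bundleChart_source.1 (hOp hw)
    have := h2 _ (bundleChart_mem_target_inter hw' hw)
    rwa [tfieldCoords_bundleChart hw'] at this

lemma isVerticalFieldOn_constField {p : M} {O : Set (TangentBundle 𝓘(ℝ, E) M)} (hO : IsOpen O)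
    (hOp : O ⊆ (bundleChart E p).source) (v : E) :
    IsVerticalFieldOn (constField p (0, v)) O := by
  refine (isVerticalFieldOn_iff hO hOp _).2 ⟨(smoothTFieldOn_iff hO hOp _).1
    (smoothTFieldOn_constField hO hOp _), fun z hz => ?_⟩
  rw [tfieldCoords_constField hz.1]

lemma isVerticalFieldOn_canonicalField {p : M} {O : Set (TangentBundle 𝓘(ℝ, E) M)}
    (hO : IsOpen O) (hOp : O ⊆ (bundleChart E p).source) :
    IsVerticalFieldOn canonicalField O := by
  refine (isVerticalFieldOn_iff hO hOp _).2 ⟨?_, fun z hz => ?_⟩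
  · exact (contDiff_const.prodMk contDiff_snd).contDiffOn.congr
      fun z hz => tfieldCoords_canonicalField hz.1
  · rw [tfieldCoords_canonicalField hz.1]

lemma isVerticalFieldOn_almostTangentField {p : M} {O : Set (TangentBundle 𝓘(ℝ, E) M)}
    (hO : IsOpen O) (hOp : O ⊆ (bundleChart E p).source)
    {X : (w : TangentBundle 𝓘(ℝ, E) M) → TTangent w} (hX : SmoothTFieldOn X O) :
    IsVerticalFieldOn (almostTangentField X) O := by
  refine (isVerticalFieldOn_iff hO hOp _).2 ⟨?_, fun z hz => ?_⟩
  · exact (contDiffOn_const.prodMk ((smoothTFieldOn_iff hO hOp X).1 hX).fst).congr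
      fun z hz => tfieldCoords_almostTangentField hz.1 X
  · rw [tfieldCoords_almostTangentField hz.1]

end VerticalCoordinates

/-! ### Locality, verticality and finite additivity of ∇ -/

section Connection

variable {E : Type*} [NormedAddCommGroup E] [NormedSpace ℝ E]
  {M : Type*} [TopologicalSpace M] [ChartedSpace E M] [IsManifold 𝓘(ℝ, E) ∞ M]

namespace VerticalConnection

variable (D : VerticalConnection E M)

/-- Locality comes from the Leibniz rule without bump functions. The indicator f of O is constant on
O, so the rule applies to it there, and fY = fZ as functions on all of TM. The terms with df agree
since Y w = Z w, and they cancel. -/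
lemma cov_congr {O : Set (TangentBundle 𝓘(ℝ, E) M)} (hO : IsOpen O) (hOs : O ⊆ slit E M)
    {Y Z : (w : TangentBundle 𝓘(ℝ, E) M) → TTangent w} (hY : IsVerticalFieldOn Y O)
    (hZ : IsVerticalFieldOn Z O) (h : ∀ w ∈ O, Y w = Z w)
    {w : TangentBundle 𝓘(ℝ, E) M} (hw : w ∈ O) (ξ : TTangent w) :
    D.cov Y w ξ = D.cov Z w ξ := by
  classical
  let f : TangentBundle 𝓘(ℝ, E) M → ℝ := O.indicator 1
  have hf : ContMDiffOn 𝓘(ℝ, E).tangent 𝓘(ℝ, ℝ) ∞ f O :=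
    (contMDiffOn_const (c := (1 : ℝ))).congr fun z hz => by simp [f, hz]
  have hfw : f w = 1 := by simp [f, hw]
  have h1 := D.leibniz O hO hOs f Y hf hY w hw ξ
  have h2 := D.leibniz O hO hOs f Z hf hZ w hw ξ
  have h3 : (fun z => f z • Y z) = fun z => f z • Z z := by
    ext1 z
    by_cases hz : z ∈ O
    · rw [h z hz]
    · simp [f, hz]
  rw [h3, h2, h w hw, hfw, one_smul, one_smul] at h1
  exact (add_left_cancel h1).symm

/-- Verticality is provided only for derivatives along smooth fields, so ξ is extended to a field
constant in the chart. -/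
lemma isVertical_cov {O : Set (TangentBundle 𝓘(ℝ, E) M)} (hO : IsOpen O) (hOs : O ⊆ slit E M)
    {Y : (w : TangentBundle 𝓘(ℝ, E) M) → TTangent w} (hY : IsVerticalFieldOn Y O)
    {w : TangentBundle 𝓘(ℝ, E) M} (hw : w ∈ O) (ξ : TTangent w) :
    IsVertical (D.cov Y w ξ) := by
  set p := w.1
  set O' := O ∩ (bundleChart E p).source
  have hO' : IsOpen O' := hO.inter (isOpen_bundleChart_source p)
  have hY' : IsVerticalFieldOn Y O' :=
    ⟨hY.smooth.mono inter_subset_left, fun z hz => hY.vertical z hz.1⟩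
  have h1 := D.smooth O' hO' (inter_subset_left.trans hOs) (constField p (tcoords p w ξ)) Y
    (smoothTFieldOn_constField hO' inter_subset_right _) hY'
  have hp : w.1 ∈ (extChartAt 𝓘(ℝ, E) p).source := mem_chart_base w.1
  have h2 := h1.vertical w ⟨hw, mem_bundleChart_source.2 hp⟩
  have h3 : constField p (tcoords p w ξ) w = ξ :=
    tcoords_injective hp (tcoords_constField hp _)
  rwa [h3] at h2

lemma cov_sum {ι : Type*} (s : Finset ι) {O : Set (TangentBundle 𝓘(ℝ, E) M)} (hO : IsOpen O)
    (hOs : O ⊆ slit E M) {p : M} (hOp : O ⊆ (bundleChart E p).source)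
    (Y : ι → (w : TangentBundle 𝓘(ℝ, E) M) → TTangent w)
    (hY : ∀ i, IsVerticalFieldOn (Y i) O) :
    IsVerticalFieldOn (fun z => ∑ i ∈ s, Y i z) O ∧
      ∀ w ∈ O, ∀ ξ : TTangent w,
        D.cov (fun z => ∑ i ∈ s, Y i z) w ξ = ∑ i ∈ s, D.cov (Y i) w ξ := by
  classical
  induction s using Finset.induction_on with
  | empty =>
    have h0 : IsVerticalFieldOn
        (fun z : TangentBundle 𝓘(ℝ, E) M => ∑ i ∈ (∅ : Finset ι), Y i z) O := by
      refine (isVerticalFieldOn_iff hO hOp _).2 ⟨?_, fun z hz => ?_⟩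
      · refine (contDiffOn_const (c := (0 : E × E))).congr fun z hz => ?_
        simp only [Finset.sum_empty, tfieldCoords, fieldCoords, map_zero]
      · simp only [Finset.sum_empty, tfieldCoords, fieldCoords, map_zero, Prod.fst_zero]
    refine ⟨h0, fun w hw ξ => ?_⟩
    -- The zero field satisfies ∇0 = ∇0 + ∇0, so ∇0 = 0.
    have h1 := D.add O hO hOs _ _ h0 h0 w hw ξ
    simp only [Finset.sum_empty, add_zero] at h1 ⊢
    exact left_eq_add.1 h1
  | insert i s hi ih =>
    have h2 : (fun z : TangentBundle 𝓘(ℝ, E) M => ∑ j ∈ insert i s, Y j z) =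
        fun z => Y i z + ∑ j ∈ s, Y j z := by
      ext1 z
      rw [Finset.sum_insert hi]
    rw [h2]
    constructor
    · have h3 := (isVerticalFieldOn_iff hO hOp _).1 (hY i)
      have h4 := (isVerticalFieldOn_iff hO hOp _).1 ih.1
      have h5 : tfieldCoords p (fun z => Y i z + ∑ j ∈ s, Y j z) =
          fun z => tfieldCoords p (Y i) z + tfieldCoords p (fun z => ∑ j ∈ s, Y j z) z := by
        ext1 z
        simp only [tfieldCoords, fieldCoords, map_add]
      refine (isVerticalFieldOn_iff hO hOp _).2 ⟨?_, fun z hz => ?_⟩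
      · rw [h5]
        exact h3.1.add h4.1
      · rw [h5, Prod.fst_add, h3.2 z hz, h4.2 z hz, add_zero]
    · intro w hw ξ
      rw [D.add O hO hOs _ _ (hY i) ih.1 w hw ξ, ih.2 w hw ξ, Finset.sum_insert hi]

end VerticalConnection

end Connection

/-! ### Christoffel symbols and the nonlinear connection coefficients -/

section Christoffel

variable {E : Type*} [NormedAddCommGroup E] [NormedSpace ℝ E]
  {M : Type*} [TopologicalSpace M] [ChartedSpace E M] [IsManifold 𝓘(ℝ, E) ∞ M]

namespace VerticalConnection

variable (D : VerticalConnection E M)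

/-- Expand Y in the frame of constant vertical fields given by a basis of E. At a zero of Y all
coefficients vanish, so in the Leibniz rule only their derivatives survive. -/
lemma tcoords_cov_of_eq_zero [FiniteDimensional ℝ E] {p : M}
    {O : Set (TangentBundle 𝓘(ℝ, E) M)} (hO : IsOpen O) (hOp : O ⊆ chartSlit E p)
    {Y : (w : TangentBundle 𝓘(ℝ, E) M) → TTangent w} (hY : IsVerticalFieldOn Y O)
    {w : TangentBundle 𝓘(ℝ, E) M} (hw : w ∈ O) (hYw : Y w = 0) (ξ : TTangent w) :
    (tcoords p w (D.cov Y w ξ)).2 =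
      (fderiv ℝ (tfieldCoords p Y) (bundleChart E p w) (tcoords p w ξ)).2 := by
  have hOs : O ⊆ slit E M := hOp.trans (chartSlit_subset_slit p)
  have hOc : O ⊆ (bundleChart E p).source := hOp.trans (chartSlit_subset_source p)
  have hwp : w.1 ∈ (extChartAt 𝓘(ℝ, E) p).source := (hOp hw).1
  set b := Module.finBasis ℝ E
  set g : Fin (Module.finrank ℝ E) → E × E → ℝ :=
    fun i z => (LinearMap.toContinuousLinearMap (b.coord i)) (tfieldCoords p Y z).2 with hg
  set f : Fin (Module.finrank ℝ E) → TangentBundle 𝓘(ℝ, E) M → ℝ :=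
    fun i z => g i (bundleChart E p z) with hf
  have hYc := (isVerticalFieldOn_iff hO hOc Y).1 hY
  have hΩ := isOpen_bundleChart_target_inter p hO
  have hwΩ := bundleChart_mem_target_inter hwp hw
  have hgs : ∀ i, ContDiffOn ℝ ∞ (g i)
      ((bundleChart E p).target ∩ (bundleChart E p).symm ⁻¹' O) := fun i =>
    (ContinuousLinearMap.contDiff _).comp_contDiffOn hYc.1.snd
  have hfs : ∀ i, ContMDiffOn 𝓘(ℝ, E).tangent 𝓘(ℝ, ℝ) ∞ (f i) O := fun i =>
    contMDiffOn_comp_extChartAt hOc (hgs i)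
  have hE : ∀ i, IsVerticalFieldOn (constField p (0, b i)) O := fun i =>
    isVerticalFieldOn_constField hO hOc (b i)
  have hfE : ∀ i, IsVerticalFieldOn (fun z => f i z • constField p (0, b i) z) O := by
    intro i
    refine (isVerticalFieldOn_iff hO hOc _).2 ⟨?_, fun z hz => ?_⟩
    · refine ((hgs i).smul (contDiffOn_const (c := ((0, b i) : E × E)))).congr fun z hz => ?_
      simp only [tfieldCoords, fieldCoords, map_smul]
      have h1 := tfieldCoords_constField hz.1 (0, b i)
      simp only [tfieldCoords, fieldCoords] at h1
      rw [hf]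
      congr 1
      exact congrArg (g i) ((bundleChart E p).right_inv hz.1)
    · have h1 := congrArg Prod.fst (tfieldCoords_constField hz.1 (0, b i))
      simp only [tfieldCoords, fieldCoords] at h1
      simp only [tfieldCoords, fieldCoords, map_smul, Prod.smul_fst, h1, smul_zero]
  have hsum := cov_sum D Finset.univ hO hOs hOc _ hfE
  have heq : ∀ z ∈ O, Y z = ∑ i, f i z • constField p (0, b i) z := by
    intro z hz
    have hzp := mem_bundleChart_source.1 (hOc hz)
    refine tcoords_injective hzp ?_
    rw [map_sum]
    simp only [map_smul, tcoords_constField hzp]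
    have h0 := hYc.2 _ (bundleChart_mem_target_inter hzp hz)
    rw [tfieldCoords_bundleChart hzp] at h0
    refine Prod.ext ?_ ?_
    · rw [h0]
      simp [Prod.fst_sum]
    · rw [Prod.snd_sum]
      have := b.sum_repr (tcoords p z (Y z)).2
      conv_lhs => rw [← this]
      refine Finset.sum_congr rfl fun i _ => ?_
      simp [hf, hg, tfieldCoords_bundleChart hzp]
  rw [D.cov_congr hO hOs hY hsum.1 heq hw ξ, hsum.2 w hw ξ, map_sum, Prod.snd_sum]
  have hYd : DifferentiableAt ℝ (tfieldCoords p Y) (bundleChart E p w) :=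
    (hYc.1.contDiffAt (hΩ.mem_nhds hwΩ)).differentiableAt (by simp)
  have hfd : ∀ i, mfderiv 𝓘(ℝ, E).tangent 𝓘(ℝ, ℝ) (f i) w ξ =
      b.coord i (fderiv ℝ (tfieldCoords p Y) (bundleChart E p w) (tcoords p w ξ)).2 := by
    intro i
    have hgd : HasFDerivAt (g i) ((LinearMap.toContinuousLinearMap (b.coord i)).comp
        ((ContinuousLinearMap.snd ℝ E E).comp
          (fderiv ℝ (tfieldCoords p Y) (bundleChart E p w)))) (bundleChart E p w) :=
      (ContinuousLinearMap.hasFDerivAt _).comp _ hYd.hasFDerivAt.snd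
    have := mfderiv_comp_extChartAt_apply (I := 𝓘(ℝ, E).tangent) (hOc hw) (g := g i)
      hgd.differentiableAt ξ
    refine this.trans ?_
    change fderiv ℝ (g i) (bundleChart E p w) _ = _
    rw [hgd.fderiv]
    rfl
  have hterm : ∀ i, (tcoords p w (D.cov (fun z => f i z • constField p (0, b i) z) w ξ)).2 =
      b.repr (fderiv ℝ (tfieldCoords p Y) (bundleChart E p w) (tcoords p w ξ)).2 i • b i := by
    intro i
    have hfw : f i w = 0 := by
      simp [hf, hg, tfieldCoords_bundleChart hwp, hYw]
    rw [D.leibniz O hO hOs (f i) _ (hfs i) (hE i) w hw ξ, hfd, hfw, zero_smul, add_zero, map_smul,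
      tcoords_constField hwp]
    rfl
  rw [Finset.sum_congr rfl fun i _ => hterm i, b.sum_repr]

/-- The Christoffel symbol of a connection in the chart induced by the preferred chart at `p`. -/
noncomputable def christoffel (p : M) (w : TangentBundle 𝓘(ℝ, E) M) (ξ : TTangent w) (v : E) : E :=
  (tcoords p w (D.cov (constField p (0, v)) w ξ)).2

/-- Subtracting the constant field with the value of Y at w reduces to a field vanishing at w. The
subtracted field contributes the Christoffel term, by definition. -/
lemma tcoords_cov [FiniteDimensional ℝ E] {p : M}
    {O : Set (TangentBundle 𝓘(ℝ, E) M)} (hO : IsOpen O) (hOp : O ⊆ chartSlit E p)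
    {Y : (w : TangentBundle 𝓘(ℝ, E) M) → TTangent w} (hY : IsVerticalFieldOn Y O)
    {w : TangentBundle 𝓘(ℝ, E) M} (hw : w ∈ O) (ξ : TTangent w) :
    (tcoords p w (D.cov Y w ξ)).2 =
      (fderiv ℝ (tfieldCoords p Y) (bundleChart E p w) (tcoords p w ξ)).2 +
        D.christoffel p w ξ (tcoords p w (Y w)).2 := by
  have hOs : O ⊆ slit E M := hOp.trans (chartSlit_subset_slit p)
  have hOc : O ⊆ (bundleChart E p).source := hOp.trans (chartSlit_subset_source p)
  have hwp : w.1 ∈ (extChartAt 𝓘(ℝ, E) p).source := (hOp hw).1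
  have hYc := (isVerticalFieldOn_iff hO hOc Y).1 hY
  have hΩ := isOpen_bundleChart_target_inter p hO
  have hwΩ := bundleChart_mem_target_inter hwp hw
  have hYd : DifferentiableAt ℝ (tfieldCoords p Y) (bundleChart E p w) :=
    (hYc.1.contDiffAt (hΩ.mem_nhds hwΩ)).differentiableAt (by simp)
  set v := (tcoords p w (Y w)).2 with hv
  set K : (w : TangentBundle 𝓘(ℝ, E) M) → TTangent w := constField p (0, v) with hK
  have hKv : IsVerticalFieldOn K O := isVerticalFieldOn_constField hO hOc v
  have hsub : ∀ z ∈ (bundleChart E p).target,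
      tfieldCoords p (fun z => Y z - K z) z = tfieldCoords p Y z - (0, v) := by
    intro z hz
    have h1 := tfieldCoords_constField hz (0, v)
    rw [← h1]
    simp only [tfieldCoords, fieldCoords, map_sub, hK]
  have hZ : IsVerticalFieldOn (fun z => Y z - K z) O := by
    refine (isVerticalFieldOn_iff hO hOc _).2 ⟨?_, fun z hz => ?_⟩
    · exact (hYc.1.sub contDiffOn_const).congr fun z hz => hsub z hz.1
    · rw [hsub z hz.1, Prod.fst_sub, hYc.2 z hz, sub_zero]
  have hZw : Y w - K w = 0 := by
    have h1 := hYc.2 _ hwΩ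
    rw [tfieldCoords_bundleChart hwp] at h1
    refine tcoords_injective hwp ?_
    rw [map_sub, map_zero, hK, tcoords_constField hwp]
    refine Prod.ext ?_ ?_
    · rw [Prod.fst_sub, h1, sub_zero, Prod.fst_zero]
    · rw [Prod.snd_sub, hv, sub_self, Prod.snd_zero]
  have h1 := D.tcoords_cov_of_eq_zero hO hOp hZ hw hZw ξ
  have h2 := D.add O hO hOs _ _ hZ hKv w hw ξ
  simp only [sub_add_cancel] at h2
  have h3 : tfieldCoords p (fun z => Y z - K z) =ᶠ[𝓝 (bundleChart E p w)]
      fun z => tfieldCoords p Y z - (0, v) := by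
    filter_upwards [(isOpen_bundleChart_target p).mem_nhds hwΩ.1] with z hz using hsub z hz
  rw [h3.fderiv_eq, fderiv_sub_const] at h1
  rw [h2, map_add, Prod.snd_add, h1]
  rfl

/-- Linearity of `christoffel` in the last argument is not needed elsewhere. This case is what
removes the uncontrolled Christoffel term wherever a field vanishes at the point of differentiation.
-/
lemma christoffel_zero [FiniteDimensional ℝ E] {p : M} {w : TangentBundle 𝓘(ℝ, E) M}
    (hw : w ∈ chartSlit E p) (ξ : TTangent w) : D.christoffel p w ξ 0 = 0 := by
  have h0 : constField p (0, 0) w = 0 := by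
    refine tcoords_injective hw.1 ?_
    rw [tcoords_constField hw.1, map_zero]
    rfl
  rw [christoffel, D.tcoords_cov_of_eq_zero (isOpen_chartSlit p) subset_rfl
    (isVerticalFieldOn_constField (isOpen_chartSlit p) (chartSlit_subset_source p) 0) hw h0]
  have h3 : tfieldCoords p (constField p (0, 0)) =ᶠ[𝓝 (bundleChart E p w)]
      fun z => ((0, 0) : E × E) := by
    filter_upwards [(isOpen_slitDomain p).mem_nhds (bundleChart_mem_slitDomain hw)] with z hz
      using tfieldCoords_constField (slitDomain_subset_target p hz) _
  rw [h3.fderiv_eq, fderiv_fun_const]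
  rfl

/-- The nonlinear connection coefficients of `∇` in the chart induced by the preferred chart
at `p`: the coordinates of `∇_ξ C` for the vector `ξ` with coordinates `(a, 0)`. -/
noncomputable def nonlinear (p : M) (z : E × E) : E →L[ℝ] E :=
  (ContinuousLinearMap.snd ℝ E E).comp
    ((tcoords p ((bundleChart E p).symm z)).comp
      ((D.cov canonicalField ((bundleChart E p).symm z)).comp
        (((trivializationAt (E × E) (TangentSpace 𝓘(ℝ, E).tangent)
          (⟨p, 0⟩ : TangentBundle 𝓘(ℝ, E) M)).symmL ℝ ((bundleChart E p).symm z)).comp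
            (ContinuousLinearMap.inl ℝ E E))))

lemma nonlinear_apply {p : M} {z : E × E} (hz : z ∈ (bundleChart E p).target) (a : E) :
    D.nonlinear p z a = (tfieldCoords p
      (fun w => D.cov canonicalField w (constField p (a, 0) w)) z).2 := by
  set w := (bundleChart E p).symm z
  have h1 : (trivializationAt (E × E) (TangentSpace 𝓘(ℝ, E).tangent)
      (⟨p, 0⟩ : TangentBundle 𝓘(ℝ, E) M)).symmL ℝ w ((a, 0) : E × E) =
        constField p (a, 0) w := by
    refine tcoords_injective (symm_mem_source hz) ?_
    rw [tcoords_constField (symm_mem_source hz), Bundle.Trivialization.symmL_apply]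
    · exact coords_trivializationAt_symm ((bundleChart E p).map_target hz) _
    · rw [TangentBundle.trivializationAt_baseSet, ← extChartAt_source 𝓘(ℝ, E).tangent]
      exact (bundleChart E p).map_target hz
  exact congrArg (fun ξ : TTangent w => (tcoords p w (D.cov canonicalField w ξ)).2) h1

/-- As E is finite-dimensional, smoothness of an operator-valued map can be tested on each vector a.
There it is smoothness of ∇_X C for the constant field X = (a, 0). -/
lemma contDiffOn_nonlinear [FiniteDimensional ℝ E] (p : M) :
    ContDiffOn ℝ ∞ (D.nonlinear p) (slitDomain E p) := by
  rw [contDiffOn_clm_apply]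
  intro a
  have hO := isOpen_chartSlit (E := E) p
  have hOc := chartSlit_subset_source (E := E) p
  have h1 := D.smooth _ hO (chartSlit_subset_slit p) _ _
    (smoothTFieldOn_constField hO hOc (a, 0)) (isVerticalFieldOn_canonicalField hO hOc)
  have h2 := ((isVerticalFieldOn_iff hO hOc _).1 h1).1
  rw [target_inter_preimage_chartSlit] at h2
  exact h2.snd.congr fun z hz => D.nonlinear_apply (slitDomain_subset_target p hz) a

/-- Split ξ = (0, b) + (a, 0): almost-projectability returns the vertical part unchanged, and the
other part defines `nonlinear`. -/
lemma tcoords_cov_canonicalField (hD : D.IsAlmostProjectable) {p : M}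
    {w : TangentBundle 𝓘(ℝ, E) M} (hw : w ∈ chartSlit E p) (ξ : TTangent w) :
    (tcoords p w (D.cov canonicalField w ξ)).2 =
      (tcoords p w ξ).2 + D.nonlinear p (bundleChart E p w) (tcoords p w ξ).1 := by
  set a := (tcoords p w ξ).1
  set b := (tcoords p w ξ).2
  have h1 : ξ = constField p (0, b) w + constField p (a, 0) w := by
    refine tcoords_injective hw.1 ?_
    rw [map_add, tcoords_constField hw.1, tcoords_constField hw.1]
    simp [a, b]
  have h2 : IsVertical (constField p ((0, b) : E × E) w) := by
    rw [isVertical_iff hw.1, tcoords_constField hw.1]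
  have h3 := hD w hw.2 _ h2
  rw [D.nonlinear_apply (slitDomain_subset_target p (bundleChart_mem_slitDomain hw)),
    tfieldCoords_bundleChart hw.1]
  conv_lhs => rw [h1]
  rw [map_add, h3, map_add, Prod.snd_add, tcoords_constField hw.1]

/-- The representation of C is (0, y), with derivative b in the direction (a, b). Comparing
`tcoords_cov` with `tcoords_cov_canonicalField` and cancelling b leaves the value of the Christoffel
term on y. -/
lemma christoffel_canonicalField [FiniteDimensional ℝ E] (hD : D.IsAlmostProjectable) {p : M}
    {w : TangentBundle 𝓘(ℝ, E) M} (hw : w ∈ chartSlit E p) (ξ : TTangent w) :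
    D.christoffel p w ξ (coords 𝓘(ℝ, E) p w.1 w.2) =
      D.nonlinear p (bundleChart E p w) (tcoords p w ξ).1 := by
  have hO := isOpen_chartSlit (E := E) p
  have h1 := D.tcoords_cov hO subset_rfl
    (isVerticalFieldOn_canonicalField hO (chartSlit_subset_source p)) hw ξ
  have h3 : tfieldCoords p canonicalField =ᶠ[𝓝 (bundleChart E p w)]
      fun z => ((0, z.2) : E × E) := by
    filter_upwards [(isOpen_slitDomain p).mem_nhds (bundleChart_mem_slitDomain hw)] with z hz
      using tfieldCoords_canonicalField (slitDomain_subset_target p hz)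
  have h4 : HasFDerivAt (fun z : E × E => ((0, z.2) : E × E))
      ((0 : E × E →L[ℝ] E).prod (ContinuousLinearMap.snd ℝ E E)) (bundleChart E p w) :=
    (hasFDerivAt_const _ _).prodMk hasFDerivAt_snd
  rw [D.tcoords_cov_canonicalField hD hw, h3.fderiv_eq, h4.fderiv] at h1
  have h5 : (tcoords p w (canonicalField w)).2 = coords 𝓘(ℝ, E) p w.1 w.2 := by
    rw [canonicalField, tcoords_vlift hw.1]
  rw [h5] at h1
  exact (add_left_cancel h1).symm

variable {D} {S : (w : TangentBundle 𝓘(ℝ, E) M) → TTangent w}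

lemma isHorizontal_iff (hD : D.IsLift S) {p : M} {w : TangentBundle 𝓘(ℝ, E) M}
    (hw : w ∈ chartSlit E p) (ξ : TTangent w) :
    IsHorizontal S ξ ↔
      (tcoords p w ξ).2 = -D.nonlinear p (bundleChart E p w) (tcoords p w ξ).1 := by
  have hO := isOpen_chartSlit (E := E) p
  have h1 := D.isVertical_cov hO (chartSlit_subset_slit p)
    (isVerticalFieldOn_canonicalField hO (chartSlit_subset_source p)) hw ξ
  rw [← hD.2 w hw.2 ξ, eq_neg_iff_add_eq_zero, ← D.tcoords_cov_canonicalField hD.1 hw]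
  refine ⟨fun h => by rw [h, map_zero]; rfl, fun h => tcoords_injective hw.1 ?_⟩
  rw [map_zero]
  exact Prod.ext ((isVertical_iff hw.1 _).1 h1) h

lemma hlift_spec (hD : D.IsLift S) {w : TangentBundle 𝓘(ℝ, E) M} (hw : w ∈ slit E M)
    (u : TangentSpace 𝓘(ℝ, E) w.1) :
    IsHorizontal S (hlift S w u) ∧ dproj w (hlift S w u) = u := by
  have hw' : w ∈ chartSlit E w.1 := ⟨mem_chart_base w.1, hw⟩
  refine Classical.epsilon_spec (p := fun ξ : TTangent w => IsHorizontal S ξ ∧ dproj w ξ = u) ?_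
  set a := coords 𝓘(ℝ, E) w.1 w.1 u
  refine ⟨constField w.1 (a, -D.nonlinear w.1 (bundleChart E w.1 w) a) w, ?_, ?_⟩
  · rw [isHorizontal_iff hD hw', tcoords_constField hw'.1]
  · refine coords_injective hw'.1 ?_
    rw [← tcoords_fst hw'.1, tcoords_constField hw'.1]

lemma tcoords_hlift (hD : D.IsLift S) {p : M} {w : TangentBundle 𝓘(ℝ, E) M}
    (hw : w ∈ chartSlit E p) (u : TangentSpace 𝓘(ℝ, E) w.1) :
    tcoords p w (hlift S w u) = (coords 𝓘(ℝ, E) p w.1 u,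
      -D.nonlinear p (bundleChart E p w) (coords 𝓘(ℝ, E) p w.1 u)) := by
  obtain ⟨h1, h2⟩ := hlift_spec hD hw.2 u
  rw [isHorizontal_iff hD hw] at h1
  have h3 : (tcoords p w (hlift S w u)).1 = coords 𝓘(ℝ, E) p w.1 u := by
    rw [tcoords_fst hw.1, h2]
  rw [h3] at h1
  exact Prod.ext h3 h1

lemma coords_affine [FiniteDimensional ℝ E] {p : M} {w : TangentBundle 𝓘(ℝ, E) M}
    (hD : D.IsLift S)
    (hw : w ∈ chartSlit E p) (u : TangentSpace 𝓘(ℝ, E) w.1)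
    {V : (x : M) → TangentSpace 𝓘(ℝ, E) x} {O : Set M} (hO : IsOpen O) (hwO : w.1 ∈ O)
    (hV : SmoothFieldOn V O) :
    coords 𝓘(ℝ, E) p w.1 (D.affine S w u V) =
      fderiv ℝ (fieldCoords 𝓘(ℝ, E) p V) (extChartAt 𝓘(ℝ, E) p w.1) (coords 𝓘(ℝ, E) p w.1 u) +
        D.christoffel p w (hlift S w u) (coords 𝓘(ℝ, E) p w.1 (V w.1)) := by
  set O' : Set (TangentBundle 𝓘(ℝ, E) M) := chartSlit E p ∩ {z | z.1 ∈ O}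
  have hO' : IsOpen O' := (isOpen_chartSlit p).inter
    (hO.preimage (FiberBundle.continuous_proj E (TangentSpace 𝓘(ℝ, E) (M := M))))
  have hO'p : O' ⊆ chartSlit E p := inter_subset_left
  have hO'c := hO'p.trans (chartSlit_subset_source p)
  have hOs : IsOpen (O ∩ (extChartAt 𝓘(ℝ, E) p).source) := hO.inter (isOpen_extChartAt_source p)
  have hVs : ContDiffOn ℝ ∞ (fieldCoords 𝓘(ℝ, E) p V) ((extChartAt 𝓘(ℝ, E) p).target ∩
      (extChartAt 𝓘(ℝ, E) p).symm ⁻¹' (O ∩ (extChartAt 𝓘(ℝ, E) p).source)) :=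
    (contMDiffOn_section_iff_fieldCoords hOs inter_subset_right).1 (hV.mono inter_subset_left)
  have hVv : IsVerticalFieldOn (vliftField V) O' := by
    refine (isVerticalFieldOn_iff hO' hO'c _).2 ⟨?_, fun z hz => ?_⟩
    · refine (contDiffOn_const.prodMk (hVs.comp contDiffOn_fst fun z hz => ?_)).congr
        fun z hz => tfieldCoords_vliftField hz.1 V
      have h1 := hz.1
      rw [bundleChart_target] at h1
      refine ⟨h1.1, ?_⟩
      rw [mem_preimage, ← bundleChart_symm_fst hz.1]
      exact ⟨hz.2.2, symm_mem_source hz.1⟩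
    · rw [tfieldCoords_vliftField hz.1]
  have hwO' : w ∈ O' := ⟨hw, hwO⟩
  have hv := D.isVertical_cov hO' (hO'p.trans (chartSlit_subset_slit p)) hVv hwO' (hlift S w u)
  rw [affine, coords_vliftInv hw.1 hv, D.tcoords_cov hO' hO'p hVv hwO', vliftField,
    tcoords_vlift hw.1]
  congr 1
  have h3 : tfieldCoords p (vliftField V) =ᶠ[𝓝 (bundleChart E p w)]
      fun z => ((0, fieldCoords 𝓘(ℝ, E) p V z.1) : E × E) := by
    filter_upwards [(isOpen_slitDomain p).mem_nhds (bundleChart_mem_slitDomain hw)] with z hz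
      using tfieldCoords_vliftField (slitDomain_subset_target p hz) V
  have h5 : (bundleChart E p w).1 = extChartAt 𝓘(ℝ, E) p w.1 := by
    rw [bundleChart_apply hw.1]
  have h6 : DifferentiableAt ℝ (fieldCoords 𝓘(ℝ, E) p V) (bundleChart E p w).1 := by
    rw [h5]
    refine (hVs.contDiffAt ((isOpen_target_inter_preimage p hOs).mem_nhds
      ⟨(extChartAt 𝓘(ℝ, E) p).map_source hw.1, ?_⟩)).differentiableAt (by simp)
    rw [mem_preimage, (extChartAt 𝓘(ℝ, E) p).left_inv hw.1]
    exact ⟨hwO, hw.1⟩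
  have h4 : HasFDerivAt (fun z : E × E => ((0, fieldCoords 𝓘(ℝ, E) p V z.1) : E × E))
      ((0 : E × E →L[ℝ] E).prod ((fderiv ℝ (fieldCoords 𝓘(ℝ, E) p V) (bundleChart E p w).1).comp
        (ContinuousLinearMap.fst ℝ E E))) (bundleChart E p w) :=
    (hasFDerivAt_const _ _).prodMk (h6.hasFDerivAt.comp (bundleChart E p w) hasFDerivAt_fst)
  rw [h3.fderiv_eq, h4.fderiv, h5, tcoords_hlift hD hw]
  rfl

end VerticalConnection

end Christoffel

/-! ### The spray, condition (T1) and the curvature endomorphism in coordinates -/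

section Spray

variable {E : Type*} [NormedAddCommGroup E] [NormedSpace ℝ E]
  {M : Type*} [TopologicalSpace M] [ChartedSpace E M] [IsManifold 𝓘(ℝ, E) ∞ M]
  {S : (w : TangentBundle 𝓘(ℝ, E) M) → TTangent w}

/-- The vertical component of a spray in the chart induced by the preferred chart at `p`. -/
noncomputable def sprayCoeff (S : (w : TangentBundle 𝓘(ℝ, E) M) → TTangent w) (p : M)
    (z : E × E) : E :=
  (tfieldCoords p S z).2

omit [IsManifold 𝓘(ℝ, E) ∞ M] in
lemma eventuallyEq_slitDomain {G : Type*} {p : M} {z : E × E} (hz : z ∈ slitDomain E p)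
    {f g : E × E → G} (h : ∀ z ∈ slitDomain E p, f z = g z) : f =ᶠ[𝓝 z] g :=
  Filter.eventually_of_mem ((isOpen_slitDomain p).mem_nhds hz) h

lemma tfieldCoords_spray (hS : IsSpray S) {p : M} {z : E × E} (hz : z ∈ slitDomain E p) :
    tfieldCoords p S z = (z.2, sprayCoeff S p z) := by
  have hz' := slitDomain_subset_target p hz
  have h1 := hS.almostTangent_eq _ (symm_mem_chartSlit hz).2
  have h2 := tfieldCoords_canonicalField hz'
  have h3 := tfieldCoords_almostTangentField hz' S
  have h4 : tfieldCoords p (almostTangentField S) z = tfieldCoords p canonicalField z :=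
    congrArg _ h1
  rw [h2, h3] at h4
  exact Prod.ext (congrArg Prod.snd h4) rfl

lemma contDiffOn_tfieldCoords_spray (hS : IsSpray S) (p : M) :
    ContDiffOn ℝ ∞ (tfieldCoords p S) (slitDomain E p) := by
  have h := (smoothTFieldOn_iff (isOpen_chartSlit p) (chartSlit_subset_source p) S).1
    (hS.smooth.mono (chartSlit_subset_slit p))
  rwa [target_inter_preimage_chartSlit] at h

lemma contDiffOn_sprayCoeff (hS : IsSpray S) (p : M) :
    ContDiffOn ℝ ∞ (sprayCoeff S p) (slitDomain E p) :=
  (contDiffOn_tfieldCoords_spray hS p).snd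

lemma differentiableAt_sprayCoeff (hS : IsSpray S) {p : M} {z : E × E}
    (hz : z ∈ slitDomain E p) : DifferentiableAt ℝ (sprayCoeff S p) z :=
  ((contDiffOn_sprayCoeff hS p).contDiffAt ((isOpen_slitDomain p).mem_nhds hz)).differentiableAt
    (by simp)

lemma fderiv_tfieldCoords_spray (hS : IsSpray S) {p : M} {z : E × E}
    (hz : z ∈ slitDomain E p) (v : E × E) :
    fderiv ℝ (tfieldCoords p S) z v = (v.2, fderiv ℝ (sprayCoeff S p) z v) := by
  have h1 := eventuallyEq_slitDomain hz
    (f := tfieldCoords p S) (g := fun z => (z.2, sprayCoeff S p z))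
    fun z hz => tfieldCoords_spray hS hz
  have h2 : HasFDerivAt (fun z : E × E => (z.2, sprayCoeff S p z))
      ((ContinuousLinearMap.snd ℝ E E).prod (fderiv ℝ (sprayCoeff S p) z)) z :=
    hasFDerivAt_snd.prodMk (differentiableAt_sprayCoeff hS hz).hasFDerivAt
  rw [h1.fderiv_eq, h2.fderiv]
  rfl

/-- Euler's relation for a coefficient 2-homogeneous in y. With C = (0, y) and S = (y, f), the
second component of [C, S] = S reads f_y y - f = f. -/
lemma fderiv_sprayCoeff_euler [CompleteSpace E] (hS : IsSpray S) {p : M} {z : E × E}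
    (hz : z ∈ slitDomain E p) :
    fderiv ℝ (sprayCoeff S p) z (0, z.2) = (2 : ℝ) • sprayCoeff S p z := by
  set w := (bundleChart E p).symm z with hw
  have hwc : w ∈ chartSlit E p := symm_mem_chartSlit hz
  have hz' := slitDomain_subset_target p hz
  have hwz : bundleChart E p w = z := (bundleChart E p).right_inv hz'
  have hO := isOpen_chartSlit (E := E) p
  have h1 := tcoords_bracket hwc.1 hO hwc
    (isVerticalFieldOn_canonicalField hO (chartSlit_subset_source p)).smooth
    (hS.smooth.mono (chartSlit_subset_slit p))
  have h2 := eventuallyEq_slitDomain hz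
    (f := tfieldCoords p canonicalField) (g := fun z => (0, z.2))
    fun z hz => tfieldCoords_canonicalField (slitDomain_subset_target p hz)
  have h3 : HasFDerivAt (fun z : E × E => ((0 : E), z.2))
      ((0 : E × E →L[ℝ] E).prod (ContinuousLinearMap.snd ℝ E E)) z :=
    (hasFDerivAt_const _ _).prodMk hasFDerivAt_snd
  rw [hwz, hS.homogeneous w hwc.2, tfieldCoords_canonicalField hz', h2.fderiv_eq, h3.fderiv,
    fderiv_tfieldCoords_spray hS hz, ← tfieldCoords_bundleChart hwc.1, hwz,
    tfieldCoords_spray hS hz] at h1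
  have h4 := congrArg Prod.snd h1
  simp only [Prod.snd_sub, ContinuousLinearMap.prod_apply, ContinuousLinearMap.coe_snd'] at h4
  rw [two_smul]
  exact (sub_eq_iff_eq_add.1 h4.symm)

/-- The chart is the one at `w.1`, where `extT ξ` is constant equal to (a, b). Hence [S, Jξ] =
-dS(0, a) = -(a, f_y a), while J[S, ξ] = (0, -b). -/
lemma tcoords_canonicalConnection [CompleteSpace E] (hS : IsSpray S)
    {w : TangentBundle 𝓘(ℝ, E) M} (hw : w ∈ slit E M) (ξ : TTangent w) :
    tcoords w.1 w (canonicalConnection S w ξ) = ((tcoords w.1 w ξ).1,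
      fderiv ℝ (sprayCoeff S w.1) (bundleChart E w.1 w) (0, (tcoords w.1 w ξ).1)
        - (tcoords w.1 w ξ).2) := by
  have hwc : w ∈ chartSlit E w.1 := ⟨mem_chart_base w.1, hw⟩
  have hO := isOpen_chartSlit (E := E) w.1
  have hOc := chartSlit_subset_source (E := E) w.1
  have hz := bundleChart_mem_slitDomain hwc
  have hz' := slitDomain_subset_target w.1 hz
  have hX : SmoothTFieldOn (extT ξ) (chartSlit E w.1) := by
    rw [smoothTFieldOn_iff hO hOc]
    exact contDiffOn_const.congr fun z hz => tfieldCoords_extT hz.1 ξ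
  have hJX := (isVerticalFieldOn_almostTangentField hO hOc hX).smooth
  have hSs := hS.smooth.mono (chartSlit_subset_slit w.1)
  set a : E := (ξ : E × E).1
  set b : E := (ξ : E × E).2
  have hJXc : ∀ z ∈ slitDomain E w.1, tfieldCoords w.1 (almostTangentField (extT ξ)) z = (0, a) :=
    fun z hz => by
      rw [tfieldCoords_almostTangentField (slitDomain_subset_target w.1 hz),
        tfieldCoords_extT (slitDomain_subset_target w.1 hz)]
  have hXc : ∀ z ∈ slitDomain E w.1, tfieldCoords w.1 (extT ξ) z = (a, b) :=
    fun z hz => tfieldCoords_extT (slitDomain_subset_target w.1 hz) ξ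
  have h1 := tcoords_bracket hwc.1 hO hwc hSs hJX
  have h2 := tcoords_bracket hwc.1 hO hwc hSs hX
  rw [hJXc _ hz, (eventuallyEq_slitDomain hz hJXc).fderiv_eq, fderiv_fun_const,
    fderiv_tfieldCoords_spray hS hz] at h1
  rw [hXc _ hz, (eventuallyEq_slitDomain hz hXc).fderiv_eq, fderiv_fun_const,
    fderiv_tfieldCoords_spray hS hz] at h2
  rw [canonicalConnection, map_neg, map_sub, tcoords_almostTangent hwc.1, h1, h2, tcoords_self]
  simp [a, b, sub_eq_neg_add]
  exact add_comm (G := E) _ _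

variable {D : VerticalConnection E M}

namespace VerticalConnection

/-- The vector (a, -Na) is fixed by Γ_S, so f_y a + Na = -Na. The nonlinear coefficients of any lift
are thus determined by the spray. -/
lemma fderiv_sprayCoeff_vertical [CompleteSpace E] (hS : IsSpray S) (hD : D.IsLift S)
    {w : TangentBundle 𝓘(ℝ, E) M} (hw : w ∈ slit E M) (a : E) :
    fderiv ℝ (sprayCoeff S w.1) (bundleChart E w.1 w) (0, a) =
      -((2 : ℝ) • D.nonlinear w.1 (bundleChart E w.1 w) a) := by
  have hwc : w ∈ chartSlit E w.1 := ⟨mem_chart_base w.1, hw⟩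
  set ξ : TTangent w := constField w.1 (a, -D.nonlinear w.1 (bundleChart E w.1 w) a) w
  have hξ : tcoords w.1 w ξ = (a, -D.nonlinear w.1 (bundleChart E w.1 w) a) :=
    tcoords_constField hwc.1 _
  have h1 : IsHorizontal S ξ := by
    rw [isHorizontal_iff hD hwc, hξ]
  have h2 := tcoords_canonicalConnection hS hw ξ
  rw [h1, hξ] at h2
  have h3 := congrArg Prod.snd h2
  simp only [sub_neg_eq_add] at h3
  rw [two_smul, eq_sub_of_add_eq h3.symm]
  abel

/-- By Euler's relation Γ_S S = (y, f_y y - f) = (y, 2f - f) = S. -/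
lemma isHorizontal_spray [CompleteSpace E] (hS : IsSpray S)
    {w : TangentBundle 𝓘(ℝ, E) M} (hw : w ∈ slit E M) : IsHorizontal S (S w) := by
  have hwc : w ∈ chartSlit E w.1 := ⟨mem_chart_base w.1, hw⟩
  have hz := bundleChart_mem_slitDomain hwc
  refine tcoords_injective hwc.1 ?_
  rw [tcoords_canonicalConnection hS hw, ← tfieldCoords_bundleChart hwc.1,
    tfieldCoords_spray hS hz, fderiv_sprayCoeff_euler hS hz]
  refine Prod.ext rfl ?_
  rw [two_smul]
  exact add_sub_cancel_right _ _

lemma sprayCoeff_eq [CompleteSpace E] (hS : IsSpray S) (hD : D.IsLift S) {p : M} {z : E × E}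
    (hz : z ∈ slitDomain E p) : sprayCoeff S p z = -D.nonlinear p z z.2 := by
  have hwc := symm_mem_chartSlit hz
  have hz' := slitDomain_subset_target p hz
  have hwz := (bundleChart E p).right_inv hz'
  have h := (isHorizontal_iff hD hwc _).1 (isHorizontal_spray hS hwc.2)
  rwa [← tfieldCoords_bundleChart hwc.1, hwz, tfieldCoords_spray hS hz] at h

/-- Differentiating with D^w in the direction w itself is therefore differentiating along S, the
direction controlled by (T1). -/
lemma hlift_self [CompleteSpace E] (hS : IsSpray S) (hD : D.IsLift S)
    {w : TangentBundle 𝓘(ℝ, E) M} (hw : w ∈ slit E M) : hlift S w w.2 = S w := by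
  have hwc : w ∈ chartSlit E w.1 := ⟨mem_chart_base w.1, hw⟩
  have hz := bundleChart_mem_slitDomain hwc
  refine tcoords_injective hwc.1 ?_
  rw [tcoords_hlift hD hwc, ← tfieldCoords_bundleChart hwc.1, tfieldCoords_spray hS hz,
    sprayCoeff_eq hS hD hz, bundleChart_apply hwc.1]

/-- Evaluate T(S, Y) = 0 on the constant field Y = (v, 0). Then JY = (0, v) and JS = C, and [S, Y] =
-dS(v, 0) is vertical, so J kills it. What remains is ∇_S(0, v) = ∇_Y C, whose vertical coordinate
is Nv. -/
lemma christoffel_spray [FiniteDimensional ℝ E] (hS : IsSpray S) (hD : D.IsLift S)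
    (hT : D.CondT1 S) {p : M} {w : TangentBundle 𝓘(ℝ, E) M} (hw : w ∈ chartSlit E p) (v : E) :
    D.christoffel p w (S w) v = D.nonlinear p (bundleChart E p w) v := by
  have : CompleteSpace E := FiniteDimensional.complete ℝ E
  have hO := isOpen_chartSlit (E := E) p
  have hOs := chartSlit_subset_slit (E := E) p
  have hOc := chartSlit_subset_source (E := E) p
  have hz := bundleChart_mem_slitDomain hw
  set Y : (w : TangentBundle 𝓘(ℝ, E) M) → TTangent w := constField p (v, 0)
  have hY : SmoothTFieldOn Y (chartSlit E p) := smoothTFieldOn_constField hO hOc _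
  have hSs := hS.smooth.mono hOs
  have h1 := hT _ hO hOs Y hY w hw
  have hJY : D.cov (almostTangentField Y) w (S w) = D.cov (constField p (0, v)) w (S w) := by
    refine D.cov_congr hO hOs (isVerticalFieldOn_almostTangentField hO hOc hY)
      (isVerticalFieldOn_constField hO hOc v) (fun z hz => tcoords_injective hz.1 ?_) hw _
    rw [almostTangentField, tcoords_almostTangent hz.1, tcoords_constField hz.1,
      tcoords_constField hz.1]
  have hJS : D.cov (almostTangentField S) w (Y w) = D.cov canonicalField w (Y w) :=
    D.cov_congr hO hOs (isVerticalFieldOn_almostTangentField hO hOc hSs)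
      (isVerticalFieldOn_canonicalField hO hOc) (fun z hz => hS.almostTangent_eq z hz.2) hw _
  have hbr := tcoords_bracket hw.1 hO hw hSs hY
  have hYc : ∀ z ∈ slitDomain E p, tfieldCoords p Y z = (v, 0) := fun z hz =>
    tfieldCoords_constField (slitDomain_subset_target p hz) _
  rw [hYc _ hz, (eventuallyEq_slitDomain hz hYc).fderiv_eq, fderiv_fun_const,
    fderiv_tfieldCoords_spray hS hz] at hbr
  rw [torsion, hJY, hJS] at h1
  have h2 := congrArg (fun ξ => (tcoords p w ξ).2) h1
  simp only [map_sub, Prod.snd_sub, map_zero, Prod.snd_zero] at h2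
  rw [tcoords_almostTangent hw.1, hbr, D.tcoords_cov_canonicalField hD.1 hw,
    tcoords_constField hw.1] at h2
  simp only [zero_add, Prod.fst_sub, sub_zero, Pi.zero_apply, zero_apply,
    Prod.fst_zero] at h2
  exact sub_eq_zero.1 h2

/-- Let Y be the extension of u^h = (a, -Na) that is constant in the chart; this forces the chart at
π(w). Horizontality makes ∇_S C vanish identically. The field ∇_Y C vanishes at w only, so its
derivative along S is its plain derivative dN(y, f)a, without Christoffel term. Finally [S, Y] =
-dS(Y) = (Na, -df(a, -Na)). -/
lemma coords_curvatureEndo [FiniteDimensional ℝ E] (hS : IsSpray S) (hD : D.IsLift S)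
    {p : M} {w : TangentBundle 𝓘(ℝ, E) M} (hp : w.1 = p) (hw : w ∈ slit E M)
    (u : TangentSpace 𝓘(ℝ, E) w.1) :
    coords 𝓘(ℝ, E) p w.1 (D.curvatureEndo S w u) =
      -fderiv ℝ (sprayCoeff S p) (bundleChart E p w) (coords 𝓘(ℝ, E) p w.1 u,
          -D.nonlinear p (bundleChart E p w) (coords 𝓘(ℝ, E) p w.1 u))
        + D.nonlinear p (bundleChart E p w)
            (D.nonlinear p (bundleChart E p w) (coords 𝓘(ℝ, E) p w.1 u))
        - fderiv ℝ (D.nonlinear p) (bundleChart E p w)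
            (coords 𝓘(ℝ, E) p w.1 w.2, sprayCoeff S p (bundleChart E p w))
            (coords 𝓘(ℝ, E) p w.1 u) := by
  have : CompleteSpace E := FiniteDimensional.complete ℝ E
  have hE : ∀ ξ : TTangent w, ∀ y ∈ (bundleChart E p).target,
      tfieldCoords p (extT ξ) y = tcoords p w ξ := by
    intro ξ y hy
    subst hp
    rw [tcoords_self]
    exact tfieldCoords_extT hy ξ
  have hwc : w ∈ chartSlit E p := ⟨hp ▸ mem_chart_base w.1, hw⟩
  set z := bundleChart E p w with hzdef
  set a := coords 𝓘(ℝ, E) p w.1 u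
  have hO := isOpen_chartSlit (E := E) p
  have hOs := chartSlit_subset_slit (E := E) p
  have hOc := chartSlit_subset_source (E := E) p
  have hz : z ∈ slitDomain E p := bundleChart_mem_slitDomain hwc
  have hz2 : z.2 = coords 𝓘(ℝ, E) p w.1 w.2 := by
    rw [hzdef, bundleChart_apply hwc.1]
  have hSs := hS.smooth.mono hOs
  have hC := isVerticalFieldOn_canonicalField hO hOc
  set ξ := hlift S w u
  have hξ : tcoords p w ξ = (a, -D.nonlinear p z a) := tcoords_hlift hD hwc u
  have hY : SmoothTFieldOn (extT ξ) (chartSlit E p) := by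
    rw [smoothTFieldOn_iff hO hOc]
    exact contDiffOn_const.congr fun z hz => hE ξ z hz.1
  have hYc : ∀ y ∈ slitDomain E p, tfieldCoords p (extT ξ) y = (a, -D.nonlinear p z a) := by
    intro y hy
    rw [← hξ, hE ξ y (slitDomain_subset_target p hy)]
  -- `∇_Y C` and its derivative along `S`
  have hYC := D.smooth _ hO hOs _ _ hY hC
  have hYCc : ∀ y ∈ slitDomain E p,
      (tfieldCoords p (fun w => D.cov canonicalField w (extT ξ w)) y).2 =
        -D.nonlinear p z a + D.nonlinear p y a := by
    intro y hy
    have h1 := D.tcoords_cov_canonicalField hD.1 (symm_mem_chartSlit hy)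
      (extT ξ ((bundleChart E p).symm y))
    rw [(bundleChart E p).right_inv (slitDomain_subset_target p hy)] at h1
    have h2 := hYc y hy
    refine h1.trans ?_
    change (tfieldCoords p (extT ξ) y).2 + D.nonlinear p y (tfieldCoords p (extT ξ) y).1 = _
    rw [h2]
  have hN : DifferentiableAt ℝ (D.nonlinear p) z :=
    ((D.contDiffOn_nonlinear p).contDiffAt ((isOpen_slitDomain p).mem_nhds hz)).differentiableAt
      (by simp)
  have hSw : tcoords p w (S w) = (coords 𝓘(ℝ, E) p w.1 w.2, sprayCoeff S p z) := by
    rw [← tfieldCoords_bundleChart hwc.1, tfieldCoords_spray hS hz, ← hz2]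
  have hA : (tcoords p w (D.cov (fun y => D.cov canonicalField y (extT ξ y)) w (S w))).2 =
      fderiv ℝ (D.nonlinear p) z (coords 𝓘(ℝ, E) p w.1 w.2, sprayCoeff S p z) a := by
    have h1 := D.tcoords_cov hO subset_rfl hYC hwc (S w)
    -- Y is horizontal at w, hence ∇_Y C = 0 there.
    have h0 : (tcoords p w (D.cov canonicalField w (extT ξ w))).2 = 0 := by
      have h := hYCc z hz
      rwa [neg_add_cancel, hzdef, tfieldCoords_bundleChart hwc.1] at h
    rw [h0, D.christoffel_zero hwc, add_zero, hSw] at h1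
    rw [h1]
    have h2 : DifferentiableAt ℝ
        (tfieldCoords p (fun w => D.cov canonicalField w (extT ξ w))) z := by
      have h3 := ((isVerticalFieldOn_iff hO hOc _).1 hYC).1
      rw [target_inter_preimage_chartSlit] at h3
      exact (h3.contDiffAt ((isOpen_slitDomain p).mem_nhds hz)).differentiableAt (by simp)
    have h4 := h2.hasFDerivAt.snd.fderiv
    rw [(eventuallyEq_slitDomain hz hYCc).fderiv_eq, fderiv_const_add] at h4
    have h5 : HasFDerivAt (fun y => D.nonlinear p y a)
        ((ContinuousLinearMap.apply ℝ E a).comp (fderiv ℝ (D.nonlinear p) z)) z :=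
      (ContinuousLinearMap.apply ℝ E a).hasFDerivAt.comp z hN.hasFDerivAt
    rw [h5.fderiv] at h4
    exact (DFunLike.congr_fun h4 _).symm
  -- `∇_S C` vanishes
  have hB : D.cov (fun y => D.cov canonicalField y (S y)) w (extT ξ w) = 0 := by
    have h0 : IsVerticalFieldOn (constField p ((0, 0) : E × E)) (chartSlit E p) :=
      isVerticalFieldOn_constField hO hOc 0
    have h1 := D.cov_congr hO hOs (D.smooth _ hO hOs _ _ hSs hC) h0 (fun y hy => by
      rw [(hD.2 y hy.2 _).2 (isHorizontal_spray hS hy.2)]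
      refine tcoords_injective hy.1 ?_
      rw [map_zero, tcoords_constField hy.1]
      rfl) hwc (extT ξ w)
    rw [h1]
    refine tcoords_injective hwc.1 (Prod.ext ?_ ?_)
    · rw [map_zero]
      exact (isVertical_iff hwc.1 _).1 (D.isVertical_cov hO hOs h0 hwc _)
    · rw [map_zero]
      exact D.christoffel_zero hwc _
  have hbr := tcoords_bracket hwc.1 hO hwc hSs hY
  rw [← hzdef, hYc _ hz, (eventuallyEq_slitDomain hz hYc).fderiv_eq, fderiv_fun_const,
    fderiv_tfieldCoords_spray hS hz] at hbr
  have hcv : IsVertical (D.curvature S (extT ξ) canonicalField w) := by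
    rw [isVertical_iff hwc.1, curvature, hB, map_sub, map_sub, map_zero, Prod.fst_sub,
      Prod.fst_sub, (isVertical_iff hwc.1 _).1 (D.isVertical_cov hO hOs hC hwc _),
      (isVertical_iff hwc.1 _).1 (D.isVertical_cov hO hOs hYC hwc _)]
    simp
  have hfin : (tcoords p w (D.curvature S (extT ξ) canonicalField w)).2 =
      -fderiv ℝ (sprayCoeff S p) z (a, -D.nonlinear p z a) + D.nonlinear p z (D.nonlinear p z a)
        - fderiv ℝ (D.nonlinear p) z (coords 𝓘(ℝ, E) p w.1 w.2, sprayCoeff S p z) a := by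
    rw [curvature, hB, map_sub, map_sub, map_zero, Prod.snd_sub, Prod.snd_sub, hA,
      D.tcoords_cov_canonicalField hD.1 hwc, hbr, ← hzdef]
    simp
  rw [← hfin]
  exact coords_vliftInv (p := p) hwc.1 hcv

end VerticalConnection

end Spray

/-! ### Covariant derivatives along curves in an arbitrary chart -/

section AlongCurves

/-- Since h(t) = 0, the difference quotient of B(τ)h(τ) at t is B(τ) applied to that of h.
Continuity of B at t therefore suffices. -/
lemma HasDerivWithinAt.clm_apply_of_eq_zero {F G : Type*} [NormedAddCommGroup F]
    [NormedSpace ℝ F] [NormedAddCommGroup G] [NormedSpace ℝ G] {B : ℝ → F →L[ℝ] G}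
    {h : ℝ → F} {h' : F} {J : Set ℝ} {t : ℝ} (hB : ContinuousWithinAt B J t)
    (hh : HasDerivWithinAt h h' J t) (h0 : h t = 0) :
    HasDerivWithinAt (fun τ => B τ (h τ)) (B t h') J t := by
  rw [hasDerivWithinAt_iff_tendsto_slope] at hh ⊢
  have h1 : slope (fun τ => B τ (h τ)) t = fun τ => B τ (slope h t τ) := by
    ext1 τ
    simp [slope_def_module, h0]
  rw [h1]
  have h2 : Filter.Tendsto B (𝓝[J \ {t}] t) (𝓝 (B t)) :=
    hB.mono_left (nhdsWithin_mono _ sdiff_subset)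
  exact (isBoundedBilinearMap_apply.continuous.tendsto (B t, h')).comp (h2.prodMk_nhds hh)

variable {E : Type*} [NormedAddCommGroup E] [NormedSpace ℝ E]
  {M : Type*} [TopologicalSpace M] [ChartedSpace E M] [IsManifold 𝓘(ℝ, E) ∞ M]
  {S : (w : TangentBundle 𝓘(ℝ, E) M) → TTangent w} {D : VerticalConnection E M}

lemma hasDerivWithinAt_velocity {γ : ℝ → M} {J : Set ℝ} {t : ℝ} {p : M}
    (hγ : MDifferentiableWithinAt 𝓘(ℝ, ℝ) 𝓘(ℝ, E) γ J t)
    (hp : γ t ∈ (extChartAt 𝓘(ℝ, E) p).source) :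
    HasDerivWithinAt (fun τ => extChartAt 𝓘(ℝ, E) p (γ τ))
      (coords 𝓘(ℝ, E) p (γ t) (velocity γ J t)) J t :=
  HasMFDerivWithinAt.hasDerivWithinAt_extChartAt hγ.hasMFDerivWithinAt hp

lemma smoothFieldOn_extM {q : M} (v : TangentSpace 𝓘(ℝ, E) q) :
    SmoothFieldOn (extM v) (extChartAt 𝓘(ℝ, E) q).source := by
  refine (contMDiffOn_section_iff_fieldCoords (isOpen_extChartAt_source q) subset_rfl).2 ?_
  exact contDiffOn_const.congr fun z hz => fieldCoords_extM hz.1 v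

lemma trivializationAt_symm_coords {p x : M} (hx : x ∈ (extChartAt 𝓘(ℝ, E) p).source)
    (v : TangentSpace 𝓘(ℝ, E) x) :
    (trivializationAt E (TangentSpace 𝓘(ℝ, E)) p).symm x (coords 𝓘(ℝ, E) p x v) = v :=
  coords_injective hx (coords_trivializationAt_symm hx _)

lemma fieldCoords_contDiffAt {p x : M} (hx : x ∈ (extChartAt 𝓘(ℝ, E) p).source)
    {V : (x : M) → TangentSpace 𝓘(ℝ, E) x} {O : Set M} (hO : IsOpen O) (hxO : x ∈ O)
    (hV : SmoothFieldOn V O) :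
    ContDiffAt ℝ ∞ (fieldCoords 𝓘(ℝ, E) p V) (extChartAt 𝓘(ℝ, E) p x) := by
  have hOs : IsOpen (O ∩ (extChartAt 𝓘(ℝ, E) p).source) := hO.inter (isOpen_extChartAt_source p)
  have h := (contMDiffOn_section_iff_fieldCoords hOs inter_subset_right).1
    (hV.mono inter_subset_left)
  refine h.contDiffAt ((isOpen_target_inter_preimage p hOs).mem_nhds
    ⟨(extChartAt 𝓘(ℝ, E) p).map_source hx, ?_⟩)
  rw [mem_preimage, (extChartAt 𝓘(ℝ, E) p).left_inv hx]
  exact ⟨hxO, hx⟩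

namespace VerticalConnection

/-- `covAlong` is defined in the chart at γ(t), which moves with t; this gives it in a fixed chart.
Let X = `extM (V t)`. In the chart at γ(t), V - X differs from V by a constant, and V - X vanishes
at t. The change of chart B thus acts on the derivative only through its value at t, giving B(V' -
X'). The affine term contributes X' and the Christoffel term, and X' cancels. -/
lemma coords_covAlong [FiniteDimensional ℝ E] (hD : D.IsLift S) {p : M} {γ : ℝ → M}
    {J : Set ℝ} {W V : (t : ℝ) → TangentSpace 𝓘(ℝ, E) (γ t)} {t : ℝ}
    (htJ : t ∈ J) (hJ : UniqueDiffWithinAt ℝ J t)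
    (hγ : MDifferentiableWithinAt 𝓘(ℝ, ℝ) 𝓘(ℝ, E) γ J t)
    (hp : γ t ∈ (extChartAt 𝓘(ℝ, E) p).source) (hW : W t ≠ 0) {V' : E}
    (hV : HasDerivWithinAt (fun τ => coords 𝓘(ℝ, E) p (γ τ) (V τ)) V' J t) :
    coords 𝓘(ℝ, E) p (γ t) (D.covAlong S γ J W V t) =
      V' + D.christoffel p ⟨γ t, W t⟩ (hlift S ⟨γ t, W t⟩ (velocity γ J t))
        (coords 𝓘(ℝ, E) p (γ t) (V t)) := by
  set q := γ t with hq
  have hqq : q ∈ (extChartAt 𝓘(ℝ, E) q).source := mem_chart_base q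
  set X := extM (V t) with hX
  have hXt : X q = V t := FiberBundle.extend_apply_self E (V t)
  have hXs : SmoothFieldOn X (extChartAt 𝓘(ℝ, E) q).source := smoothFieldOn_extM (V t)
  have haff := coords_affine hD (p := p) (w := ⟨q, W t⟩) ⟨hp, hW⟩ (velocity γ J t)
    (isOpen_extChartAt_source q) hqq hXs
  set X' := fderiv ℝ (fieldCoords 𝓘(ℝ, E) p X) (extChartAt 𝓘(ℝ, E) p q)
    (coords 𝓘(ℝ, E) p q (velocity γ J t)) with hX'
  have hXd : HasDerivWithinAt
      (fun τ => fieldCoords 𝓘(ℝ, E) p X (extChartAt 𝓘(ℝ, E) p (γ τ))) X' J t :=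
    HasFDerivAt.comp_hasDerivWithinAt (l := fieldCoords 𝓘(ℝ, E) p X)
      (f := fun τ => extChartAt 𝓘(ℝ, E) p (γ τ)) t
      ((fieldCoords_contDiffAt hp (isOpen_extChartAt_source q) hqq hXs).differentiableAt
        (by simp)).hasFDerivAt (hasDerivWithinAt_velocity hγ hp)
  set e := trivializationAt E (TangentSpace 𝓘(ℝ, E) (M := M)) p
  set e' := trivializationAt E (TangentSpace 𝓘(ℝ, E) (M := M)) q
  set B : ℝ → E →L[ℝ] E := fun τ => (e.coordChangeL ℝ e' (γ τ) : E →L[ℝ] E) with hBdef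
  have hbase : ∀ x, x ∈ e.baseSet ∩ e'.baseSet ↔
      x ∈ (extChartAt 𝓘(ℝ, E) p).source ∧ x ∈ (extChartAt 𝓘(ℝ, E) q).source := by
    intro x
    simp [e, e']
  have hBc : ContinuousWithinAt B J t := by
    have h1 := (VectorBundle.continuousOn_coordChange' (R := ℝ) e e').continuousAt
      ((e.open_baseSet.inter e'.open_baseSet).mem_nhds ((hbase q).2 ⟨hp, hqq⟩))
    exact h1.comp_continuousWithinAt hγ.continuousWithinAt
  have hBa : ∀ τ, γ τ ∈ (extChartAt 𝓘(ℝ, E) p).source →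
      γ τ ∈ (extChartAt 𝓘(ℝ, E) q).source → ∀ v : E,
      B τ v = coords 𝓘(ℝ, E) q (γ τ) (e.symm (γ τ) v) := by
    intro τ h1 h2 v
    rw [coords_eq_trivializationAt h2]
    exact e.coordChangeL_apply e' ((hbase _).2 ⟨h1, h2⟩) v
  have hBh := HasDerivWithinAt.clm_apply_of_eq_zero hBc (hV.sub hXd) (by
    rw [Pi.sub_apply, ← hq, fieldCoords_extChartAt hp, hXt, sub_self])
  -- The value at t is named as an element of the model space: it is a constant, while V τ lives in
  -- a tangent space varying with τ.
  obtain ⟨v, hv⟩ : ∃ v : E, v = V t := ⟨V t, rfl⟩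
  have hf : HasDerivWithinAt (fun τ => (e' (⟨γ τ, V τ⟩ : TangentBundle 𝓘(ℝ, E) M)).2)
      (B t (V' - X')) J t := by
    have h1 : (fun τ => (e' (⟨γ τ, V τ⟩ : TangentBundle 𝓘(ℝ, E) M)).2) =ᶠ[𝓝[J] t]
        fun τ => v + B τ (coords 𝓘(ℝ, E) p (γ τ) (V τ) -
          fieldCoords 𝓘(ℝ, E) p X (extChartAt 𝓘(ℝ, E) p (γ τ))) := by
      have h2 := hγ.continuousWithinAt.preimage_mem_nhdsWithin
        (((isOpen_extChartAt_source p).inter (isOpen_extChartAt_source q)).mem_nhds ⟨hp, hqq⟩)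
      filter_upwards [h2] with τ hτ
      rw [fieldCoords_extChartAt hτ.1, ← map_sub, hBa τ hτ.1 hτ.2,
        trivializationAt_symm_coords hτ.1, map_sub, ← coords_eq_trivializationAt hτ.2]
      have h3 : coords 𝓘(ℝ, E) q (γ τ) (X (γ τ)) = v := (coords_extend hτ.2 (V t)).trans hv.symm
      rw [h3]
      exact (add_sub_cancel v _).symm
    exact (hBh.const_add v).congr_of_eventuallyEq h1 (h1.eq_of_nhdsWithin htJ)
  have hcov : coords 𝓘(ℝ, E) p q (e'.symm q (B t (V' - X'))) = V' - X' := by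
    rw [hBa t hp hqq, trivializationAt_symm_coords hqq, coords_trivializationAt_symm hp]
  rw [covAlong, map_add, haff, hf.derivWithin hJ, hcov, hXt]
  abel

end VerticalConnection

end AlongCurves

/-! ### The geodesic equation, and the curvature identity for a vector field -/

section Identities

variable {E : Type*} [NormedAddCommGroup E] [NormedSpace ℝ E]
  {M : Type*} [TopologicalSpace M] [ChartedSpace E M] [IsManifold 𝓘(ℝ, E) ∞ M]
  {S : (w : TangentBundle 𝓘(ℝ, E) M) → TTangent w} {D : VerticalConnection E M}

/-- The second component, in the bundle chart, of the velocity curve being an integral curve of S: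
the second-order equation x'' = f(x, x'). -/
lemma IsGeodesicOn.hasDerivWithinAt_velocity {γ : ℝ → M} {J : Set ℝ}
    (hγ : IsGeodesicOn S γ J) {t : ℝ} (ht : t ∈ J) {p : M}
    (hp : γ t ∈ (extChartAt 𝓘(ℝ, E) p).source) :
    HasDerivWithinAt (fun τ => coords 𝓘(ℝ, E) p (γ τ) (velocity γ J τ))
      (sprayCoeff S p (extChartAt 𝓘(ℝ, E) p (γ t), coords 𝓘(ℝ, E) p (γ t) (velocity γ J t)))
      J t := by
  set c : ℝ → TangentBundle 𝓘(ℝ, E) M := fun τ => ⟨γ τ, velocity γ J τ⟩ with hc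
  have hct : c t ∈ chartSlit E p := ⟨hp, hγ.1 t ht⟩
  have h1 := hγ.2 t ht
  have h2 := HasMFDerivWithinAt.hasDerivWithinAt_extChartAt h1 (p := ⟨p, 0⟩)
    (mem_bundleChart_source.2 hct.1)
  have h3 : HasDerivWithinAt
      (fun τ => (extChartAt 𝓘(ℝ, E).tangent (⟨p, 0⟩ : TangentBundle 𝓘(ℝ, E) M) (c τ)).2)
      ((coords 𝓘(ℝ, E).tangent (⟨p, 0⟩ : TangentBundle 𝓘(ℝ, E) M) (c t))
        (((1 : ℝ →L[ℝ] ℝ).smulRight (S (c t))) 1)).2 J t :=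
    HasFDerivAt.comp_hasDerivWithinAt (l := Prod.snd)
      (f := fun τ => extChartAt 𝓘(ℝ, E).tangent (⟨p, 0⟩ : TangentBundle 𝓘(ℝ, E) M) (c τ)) t
      hasFDerivAt_snd h2
  have hcont : ContinuousWithinAt γ J t :=
    (FiberBundle.continuous_proj E (TangentSpace 𝓘(ℝ, E) (M := M))).continuousAt
      |>.comp_continuousWithinAt h1.continuousWithinAt
  have h4 : (fun τ => coords 𝓘(ℝ, E) p (γ τ) (velocity γ J τ)) =ᶠ[𝓝[J] t]
      fun τ => (extChartAt 𝓘(ℝ, E).tangent (⟨p, 0⟩ : TangentBundle 𝓘(ℝ, E) M) (c τ)).2 := by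
    filter_upwards [hcont.preimage_mem_nhdsWithin
      ((isOpen_extChartAt_source (I := 𝓘(ℝ, E)) p).mem_nhds hp)] with τ hτ
    exact (congrArg Prod.snd (bundleChart_apply (p := p) (w := c τ) hτ)).symm
  have h5 : ((coords 𝓘(ℝ, E).tangent (⟨p, 0⟩ : TangentBundle 𝓘(ℝ, E) M) (c t))
      (((1 : ℝ →L[ℝ] ℝ).smulRight (S (c t))) 1)).2 =
      sprayCoeff S p (extChartAt 𝓘(ℝ, E) p (γ t), coords 𝓘(ℝ, E) p (γ t) (velocity γ J t)) := by
    have h6 : ((1 : ℝ →L[ℝ] ℝ).smulRight (S (c t))) 1 = S (c t) := by simp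
    have h7 := bundleChart_apply (p := p) (w := c t) hct.1
    have h8 := congrArg Prod.snd (tfieldCoords_bundleChart hct.1 S)
    rw [h7] at h8
    rw [h6]
    exact h8.symm
  rw [← h5]
  exact h3.congr_of_eventuallyEq h4 (h4.eq_of_nhdsWithin ht)

namespace VerticalConnection

lemma christoffel_hlift_snd [FiniteDimensional ℝ E] (hD : D.IsLift S) {p : M}
    {w : TangentBundle 𝓘(ℝ, E) M} (hw : w ∈ chartSlit E p) (u : TangentSpace 𝓘(ℝ, E) w.1) :
    D.christoffel p w (hlift S w u) (coords 𝓘(ℝ, E) p w.1 w.2) =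
      D.nonlinear p (bundleChart E p w) (coords 𝓘(ℝ, E) p w.1 u) := by
  rw [D.christoffel_canonicalField hD.1 hw, tcoords_hlift hD hw]

lemma christoffel_hlift_self [FiniteDimensional ℝ E] (hS : IsSpray S) (hD : D.IsLift S)
    (hT : D.CondT1 S) {p : M} {w : TangentBundle 𝓘(ℝ, E) M} (hw : w ∈ chartSlit E p) (v : E) :
    D.christoffel p w (hlift S w w.2) v = D.nonlinear p (bundleChart E p w) v := by
  have : CompleteSpace E := FiniteDimensional.complete ℝ E
  rw [hlift_self hS hD hw.2, christoffel_spray hS hD hT hw]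

/-- In both applications df occurs at (u, a) with a the derivative of T or W in the direction u,
rather than at the horizontal vector (u, -Nu). The difference (0, a + Nu) is vertical, where df is
-2N. -/
lemma coords_curvatureEndo_eq [FiniteDimensional ℝ E] (hS : IsSpray S) (hD : D.IsLift S)
    {p : M} {w : TangentBundle 𝓘(ℝ, E) M} (hp : w.1 = p) (hw : w ∈ slit E M)
    (u : TangentSpace 𝓘(ℝ, E) w.1) (a : E) :
    coords 𝓘(ℝ, E) p w.1 (D.curvatureEndo S w u) =
      -fderiv ℝ (sprayCoeff S p) (bundleChart E p w) (coords 𝓘(ℝ, E) p w.1 u, a)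
        - fderiv ℝ (D.nonlinear p) (bundleChart E p w)
            (coords 𝓘(ℝ, E) p w.1 w.2, sprayCoeff S p (bundleChart E p w))
            (coords 𝓘(ℝ, E) p w.1 u)
        - D.nonlinear p (bundleChart E p w) a
        - D.nonlinear p (bundleChart E p w) (a + D.nonlinear p (bundleChart E p w)
            (coords 𝓘(ℝ, E) p w.1 u)) := by
  have : CompleteSpace E := FiniteDimensional.complete ℝ E
  rw [coords_curvatureEndo hS hD hp hw]
  have h1 : fderiv ℝ (sprayCoeff S p) (bundleChart E p w)
      (0, a + D.nonlinear p (bundleChart E p w) (coords 𝓘(ℝ, E) p w.1 u)) =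
      -((2 : ℝ) • D.nonlinear p (bundleChart E p w)
        (a + D.nonlinear p (bundleChart E p w) (coords 𝓘(ℝ, E) p w.1 u))) := by
    subst hp
    exact fderiv_sprayCoeff_vertical hS hD hw _
  set N := D.nonlinear p (bundleChart E p w)
  set u' := coords 𝓘(ℝ, E) p w.1 u
  have h2 : ((u', a) : E × E) = (u', -N u') + (0, a + N u') := by
    ext <;> simp
  rw [h2, map_add, h1, map_add, two_smul]
  abel

lemma fieldCoords_mem_slitDomain {p : M} {x : M} (hx : x ∈ (extChartAt 𝓘(ℝ, E) p).source)
    {v : TangentSpace 𝓘(ℝ, E) x} (hv : v ≠ 0) :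
    (extChartAt 𝓘(ℝ, E) p x, coords 𝓘(ℝ, E) p x v) ∈ slitDomain E p := by
  have h := bundleChart_mem_slitDomain (p := p) (w := (⟨x, v⟩ : TangentBundle 𝓘(ℝ, E) M)) ⟨hx, hv⟩
  rwa [bundleChart_apply hx] at h

/-- In coordinates D^W_V W = W'V + NV, and D^W_W V = V'W + NV for every V by (T1). In particular
D^W_W W = W'W - f, which is zero at x₀ by the geodesic equation. The Christoffel term in D^W_U of
this field therefore vanishes at x₀. -/
lemma affineField_curvature [FiniteDimensional ℝ E] (hS : IsSpray S) (hD : D.IsLift S)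
    (hT : D.CondT1 S) {O : Set M} {W U : (x : M) → TangentSpace 𝓘(ℝ, E) x} {x₀ : M}
    (hO : IsOpen O) (hx₀ : x₀ ∈ O) (hW : SmoothFieldOn W O) (hU : SmoothFieldOn U O)
    (hW0 : ∀ x ∈ O, W x ≠ 0) {γ : ℝ → M} {δ : ℝ} (hδ : 0 < δ) (hγ0 : γ 0 = x₀)
    (hγW : IsMIntegralCurveOn γ W (Ioo (-δ) δ)) (hγS : IsGeodesicOn S γ (Ioo (-δ) δ)) :
    D.affineField S W U (D.affineField S W W W) x₀
        - D.affineField S W W (D.affineField S W U W) x₀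
        + D.affineField S W (VectorField.mlieBracket 𝓘(ℝ, E) W U) W x₀
      = D.curvatureEndo S ⟨x₀, W x₀⟩ (U x₀) := by
  have : CompleteSpace E := FiniteDimensional.complete ℝ E
  have hx₀s := mem_chart_base (E := E) x₀
  set φ := extChartAt 𝓘(ℝ, E) x₀ with hφ
  set O' := O ∩ φ.source with hO'def
  have hO' : IsOpen O' := hO.inter (isOpen_extChartAt_source x₀)
  have hO's : O' ⊆ φ.source := inter_subset_right
  have hx₀' : x₀ ∈ O' := ⟨hx₀, hx₀s⟩
  set Q := φ.target ∩ φ.symm ⁻¹' O' with hQdef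
  have hQ : IsOpen Q := isOpen_target_inter_preimage x₀ hO'
  have hφQ : ∀ x ∈ O', φ x ∈ Q := fun x hx =>
    ⟨φ.map_source hx.2, by rw [mem_preimage, φ.left_inv hx.2]; exact hx⟩
  have hW' : SmoothFieldOn W O' := hW.mono inter_subset_left
  have hU' : SmoothFieldOn U O' := hU.mono inter_subset_left
  set W' := fieldCoords 𝓘(ℝ, E) x₀ W with hW'def
  set U' := fieldCoords 𝓘(ℝ, E) x₀ U with hU'def
  have hWs : ContDiffOn ℝ ∞ W' Q := (contMDiffOn_section_iff_fieldCoords hO' hO's).1 hW'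
  have hUs : ContDiffOn ℝ ∞ U' Q := (contMDiffOn_section_iff_fieldCoords hO' hO's).1 hU'
  have hslit : ∀ z ∈ Q, (z, W' z) ∈ slitDomain E x₀ := by
    intro z hz
    have h := fieldCoords_mem_slitDomain hz.2.2 (hW0 _ hz.2.1)
    rw [φ.right_inv hz.1] at h
    exact h
  set N := D.nonlinear x₀ with hN
  set s := sprayCoeff S x₀ with hs
  have hNs : ContDiffOn ℝ ∞ (fun z => N (z, W' z)) Q :=
    (D.contDiffOn_nonlinear x₀).comp (contDiffOn_id.prodMk hWs) hslit
  have hss : ContDiffOn ℝ ∞ (fun z => s (z, W' z)) Q :=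
    (contDiffOn_sprayCoeff hS x₀).comp (contDiffOn_id.prodMk hWs) hslit
  have hdW : ContDiffOn ℝ ∞ (fderiv ℝ W') Q := hWs.fderiv_of_isOpen hQ (by simp)
  have hslitM : ∀ x ∈ O', (⟨x, W x⟩ : TangentBundle 𝓘(ℝ, E) M) ∈ chartSlit E x₀ :=
    fun x hx => ⟨hx.2, hW0 x hx.1⟩
  have hbc : ∀ x ∈ O', bundleChart E x₀ ⟨x, W x⟩ = (φ x, W' (φ x)) := fun x hx => by
    rw [bundleChart_apply hx.2, hW'def, fieldCoords_extChartAt hx.2]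
  -- the affine connection in coordinates
  have hUW : ∀ (V : (x : M) → TangentSpace 𝓘(ℝ, E) x), ∀ x ∈ O',
      coords 𝓘(ℝ, E) x₀ x (D.affineField S W V W x) =
        fderiv ℝ W' (φ x) (coords 𝓘(ℝ, E) x₀ x (V x)) +
          N (φ x, W' (φ x)) (coords 𝓘(ℝ, E) x₀ x (V x)) := by
    intro V x hx
    have h1 := coords_affine hD (hslitM x hx) (V x) hO' hx hW'
    have h2 := christoffel_hlift_snd hD (hslitM x hx) (V x)
    rw [h2, hbc x hx] at h1
    exact h1
  have hWV : ∀ (V : (x : M) → TangentSpace 𝓘(ℝ, E) x), SmoothFieldOn V O' → ∀ x ∈ O',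
      coords 𝓘(ℝ, E) x₀ x (D.affineField S W W V x) =
        fderiv ℝ (fieldCoords 𝓘(ℝ, E) x₀ V) (φ x) (coords 𝓘(ℝ, E) x₀ x (W x)) +
          N (φ x, W' (φ x)) (coords 𝓘(ℝ, E) x₀ x (V x)) := by
    intro V hV x hx
    have h1 := coords_affine hD (hslitM x hx) (W x) hO' hx hV
    have h2 := christoffel_hlift_self hS hD hT (hslitM x hx) (coords 𝓘(ℝ, E) x₀ x (V x))
    rw [hbc x hx] at h2
    exact h1.trans (congrArg _ h2)
  have hXc : ∀ z ∈ Q, fieldCoords 𝓘(ℝ, E) x₀ (D.affineField S W W W) z =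
      fderiv ℝ W' z (W' z) - s (z, W' z) := by
    intro z hz
    have h1 := hUW W _ hz.2
    rw [← fieldCoords_extChartAt hz.2.2, ← fieldCoords_extChartAt hz.2.2,
      φ.right_inv hz.1] at h1
    rw [h1, hs, sprayCoeff_eq hS hD (hslit z hz), sub_neg_eq_add]
  have hYc : ∀ z ∈ Q, fieldCoords 𝓘(ℝ, E) x₀ (D.affineField S W U W) z =
      fderiv ℝ W' z (U' z) + N (z, W' z) (U' z) := by
    intro z hz
    have h1 := hUW U _ hz.2
    rwa [← fieldCoords_extChartAt hz.2.2, ← fieldCoords_extChartAt hz.2.2,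
      φ.right_inv hz.1] at h1
  have hXs : SmoothFieldOn (D.affineField S W W W) O' :=
    (contMDiffOn_section_iff_fieldCoords hO' hO's).2
      (((hdW.clm_apply hWs).sub hss).congr hXc)
  have hYs : SmoothFieldOn (D.affineField S W U W) O' :=
    (contMDiffOn_section_iff_fieldCoords hO' hO's).2
      (((hdW.clm_apply hUs).add (hNs.clm_apply hUs)).congr hYc)
  -- values at the base point
  set z₀ := φ x₀ with hz₀
  have hz₀Q : z₀ ∈ Q := hφQ x₀ hx₀'
  have hWz : coords 𝓘(ℝ, E) x₀ x₀ (W x₀) = W' z₀ := (fieldCoords_extChartAt hx₀s W).symm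
  have hUz : coords 𝓘(ℝ, E) x₀ x₀ (U x₀) = U' z₀ := (fieldCoords_extChartAt hx₀s U).symm
  have hdif : ∀ {G : Type _} [NormedAddCommGroup G] [NormedSpace ℝ G] {f : E → G},
      ContDiffOn ℝ ∞ f Q → HasFDerivAt f (fderiv ℝ f z₀) z₀ := fun hf =>
    ((hf.contDiffAt (hQ.mem_nhds hz₀Q)).differentiableAt (by simp)).hasFDerivAt
  have hz₀s := hslit z₀ hz₀Q
  have hWd := hdif hWs
  have hUd := hdif hUs
  have hdWd := hdif hdW
  have hgd : HasFDerivAt (fun z => (z, W' z))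
      ((ContinuousLinearMap.id ℝ E).prod (fderiv ℝ W' z₀)) z₀ := (hasFDerivAt_id z₀).prodMk hWd
  have hNd : HasFDerivAt (fun z => N (z, W' z)) ((fderiv ℝ N (z₀, W' z₀)).comp
      ((ContinuousLinearMap.id ℝ E).prod (fderiv ℝ W' z₀))) z₀ :=
    HasFDerivAt.comp (g := N) (f := fun z => (z, W' z)) z₀
      (((D.contDiffOn_nonlinear x₀).contDiffAt
        ((isOpen_slitDomain x₀).mem_nhds hz₀s)).differentiableAt (by simp)).hasFDerivAt hgd
  have hsd : HasFDerivAt (fun z => s (z, W' z)) ((fderiv ℝ s (z₀, W' z₀)).comp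
      ((ContinuousLinearMap.id ℝ E).prod (fderiv ℝ W' z₀))) z₀ :=
    HasFDerivAt.comp (g := s) (f := fun z => (z, W' z)) z₀
      (differentiableAt_sprayCoeff hS hz₀s).hasFDerivAt hgd
  have hsymm : fderiv ℝ (fderiv ℝ W') z₀ (U' z₀) (W' z₀) =
      fderiv ℝ (fderiv ℝ W') z₀ (W' z₀) (U' z₀) :=
    ((hWs.contDiffAt (hQ.mem_nhds hz₀Q)).isSymmSndFDerivAt
      (by simpa using ENat.LEInfty.out)).eq _ _
  -- the geodesic equation
  have hgeo : fderiv ℝ W' z₀ (W' z₀) = s (z₀, W' z₀) := by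
    have h0 : (0 : ℝ) ∈ Ioo (-δ) δ := ⟨by linarith, hδ⟩
    have hun : ∀ t ∈ Ioo (-δ) δ, UniqueMDiffWithinAt 𝓘(ℝ, ℝ) (Ioo (-δ) δ) t := fun t ht =>
      (isOpen_Ioo.uniqueMDiffWithinAt ht)
    have hvel : ∀ t ∈ Ioo (-δ) δ, velocity γ (Ioo (-δ) δ) t = W (γ t) := by
      intro t ht
      rw [velocity, (hγW t ht).mfderivWithin (hun t ht)]
      exact one_smul ℝ (W (γ t))
    have hγs : γ 0 ∈ φ.source := by rw [hγ0]; exact hx₀s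
    have h1 := hγS.hasDerivWithinAt_velocity h0 hγs
    have h2 := hasDerivWithinAt_velocity (hγW 0 h0).mdifferentiableWithinAt hγs
    rw [hvel 0 h0] at h1 h2
    have hcoW : coords 𝓘(ℝ, E) x₀ (γ 0) (W (γ 0)) = W' z₀ := by
      rw [← fieldCoords_extChartAt hγs, hγ0]
    have hφ0 : φ (γ 0) = z₀ := by rw [hγ0]
    rw [hcoW] at h1 h2
    have h3 : HasDerivWithinAt (fun τ => W' (φ (γ τ))) (fderiv ℝ W' z₀ (W' z₀))
        (Ioo (-δ) δ) 0 :=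
      HasFDerivAt.comp_hasDerivWithinAt (l := W') (f := fun τ => φ (γ τ)) 0
        (by rw [hφ0]; exact hWd) h2
    have h4 : (fun τ => coords 𝓘(ℝ, E) x₀ (γ τ) (velocity γ (Ioo (-δ) δ) τ))
        =ᶠ[𝓝[Ioo (-δ) δ] 0] fun τ => W' (φ (γ τ)) := by
      filter_upwards [self_mem_nhdsWithin, (hγW 0 h0).continuousWithinAt.preimage_mem_nhdsWithin
        ((isOpen_extChartAt_source (I := 𝓘(ℝ, E)) x₀).mem_nhds hγs)] with τ hτ hτs
      rw [hvel τ hτ]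
      exact (fieldCoords_extChartAt hτs W).symm
    have h5 := h3.congr_of_eventuallyEq h4 (h4.eq_of_nhdsWithin h0)
    have h6 := (isOpen_Ioo.uniqueDiffWithinAt h0).eq_deriv _ h5 h1
    rw [h6]
    exact congrArg (fun y => sprayCoeff S x₀ (y, W' z₀)) hφ0
  -- the three terms of the identity
  have hX0 : coords 𝓘(ℝ, E) x₀ x₀ (D.affineField S W W W x₀) = 0 := by
    rw [← fieldCoords_extChartAt hx₀s, hXc _ hz₀Q, hgeo, sub_self]
  have hXev : fieldCoords 𝓘(ℝ, E) x₀ (D.affineField S W W W) =ᶠ[𝓝 z₀]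
      fun z => fderiv ℝ W' z (W' z) - s (z, W' z) :=
    Filter.eventually_of_mem (hQ.mem_nhds hz₀Q) hXc
  have hYev : fieldCoords 𝓘(ℝ, E) x₀ (D.affineField S W U W) =ᶠ[𝓝 z₀]
      fun z => fderiv ℝ W' z (U' z) + N (z, W' z) (U' z) :=
    Filter.eventually_of_mem (hQ.mem_nhds hz₀Q) hYc
  have ht1 : coords 𝓘(ℝ, E) x₀ x₀ (D.affineField S W U (D.affineField S W W W) x₀) =
      fderiv ℝ W' z₀ (fderiv ℝ W' z₀ (U' z₀)) + fderiv ℝ (fderiv ℝ W') z₀ (U' z₀) (W' z₀)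
        - fderiv ℝ s (z₀, W' z₀) (U' z₀, fderiv ℝ W' z₀ (U' z₀)) := by
    have h1 := coords_affine hD (hslitM x₀ hx₀') (U x₀) hO' hx₀' hXs
    simp only at h1
    rw [hX0, D.christoffel_zero (hslitM x₀ hx₀'), add_zero] at h1
    refine h1.trans ?_
    rw [hUz, hXev.fderiv_eq, ((hdWd.clm_apply hWd).fun_sub hsd).fderiv]
    simp
  have ht2 : coords 𝓘(ℝ, E) x₀ x₀ (D.affineField S W W (D.affineField S W U W) x₀) =
      fderiv ℝ W' z₀ (fderiv ℝ U' z₀ (W' z₀)) + fderiv ℝ (fderiv ℝ W') z₀ (W' z₀) (U' z₀)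
        + (N (z₀, W' z₀) (fderiv ℝ U' z₀ (W' z₀)) +
          fderiv ℝ N (z₀, W' z₀) (W' z₀, s (z₀, W' z₀)) (U' z₀))
        + N (z₀, W' z₀) (fderiv ℝ W' z₀ (U' z₀) + N (z₀, W' z₀) (U' z₀)) := by
    rw [hWV _ hYs x₀ hx₀', ← fieldCoords_extChartAt hx₀s (D.affineField S W U W), ← hz₀, hYc _ hz₀Q,
      hWz, hYev.fderiv_eq, ((hdWd.clm_apply hUd).fun_add (hNd.clm_apply hUd)).fderiv]
    -- The derivative of N(z, W'(z)) along W is dN(W', dW'(W')); the geodesic equation replaces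
    -- dW'(W') by f.
    simp [hgeo]
  have ht3 : coords 𝓘(ℝ, E) x₀ x₀
      (D.affineField S W (VectorField.mlieBracket 𝓘(ℝ, E) W U) W x₀) =
      fderiv ℝ W' z₀ (fderiv ℝ U' z₀ (W' z₀) - fderiv ℝ W' z₀ (U' z₀)) +
        N (z₀, W' z₀) (fderiv ℝ U' z₀ (W' z₀) - fderiv ℝ W' z₀ (U' z₀)) := by
    rw [hUW _ x₀ hx₀', coords_mlieBracket hx₀s hO' hx₀' hW' hU']
  refine coords_injective hx₀s ?_
  have hR := coords_curvatureEndo_eq hS hD (p := x₀) (w := ⟨x₀, W x₀⟩) rfl (hW0 x₀ hx₀) (U x₀)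
    (fderiv ℝ W' z₀ (U' z₀))
  rw [hbc x₀ hx₀'] at hR
  simp only at hR
  rw [hUz, hWz] at hR
  rw [map_add, map_sub, ht1, ht2, ht3]
  refine Eq.trans ?_ hR.symm
  rw [hsymm]
  simp only [map_add, map_sub]
  abel

end VerticalConnection

end Identities

/-! ### One-variable slices, and intervals that may contain endpoints -/

section Slices

variable {F : Type*} [NormedAddCommGroup F] [NormedSpace ℝ F]

lemma HasFDerivWithinAt.hasDerivWithinAt_slice_snd {f : ℝ × ℝ → F} {L : ℝ × ℝ →L[ℝ] F}
    {A J : Set ℝ} {s t : ℝ} (hf : HasFDerivWithinAt f L (A ×ˢ J) (s, t)) (hs : s ∈ A) :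
    HasDerivWithinAt (fun τ => f (s, τ)) (L (0, 1)) J t :=
  hf.comp_hasDerivWithinAt (f := fun τ : ℝ => (s, τ)) t
    ((hasDerivWithinAt_const t J s).prodMk (hasDerivWithinAt_id t J)) fun _ hτ => ⟨hs, hτ⟩

lemma HasFDerivWithinAt.hasDerivWithinAt_slice_fst {f : ℝ × ℝ → F} {L : ℝ × ℝ →L[ℝ] F}
    {A J : Set ℝ} {s t : ℝ} (hf : HasFDerivWithinAt f L (A ×ˢ J) (s, t)) (ht : t ∈ J) :
    HasDerivWithinAt (fun σ => f (σ, t)) (L (1, 0)) A s :=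
  hf.comp_hasDerivWithinAt (f := fun σ : ℝ => (σ, t)) s
    ((hasDerivWithinAt_id s A).prodMk (hasDerivWithinAt_const s A t)) fun _ hσ => ⟨hσ, ht⟩

lemma OrdConnected.nonempty_interior {J : Set ℝ} (hJ : J.OrdConnected) (hJ' : J.Nontrivial) :
    (interior J).Nonempty := by
  obtain ⟨x, hx, y, hy, hxy⟩ := hJ'.exists_lt
  obtain ⟨z, hz⟩ := nonempty_Ioo.2 hxy
  exact ⟨z, interior_maximal (Ioo_subset_Icc_self.trans (hJ.out hx hy)) isOpen_Ioo hz⟩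

lemma OrdConnected.uniqueDiffOn {J : Set ℝ} (hJ : J.OrdConnected) (hJ' : J.Nontrivial) :
    UniqueDiffOn ℝ J :=
  uniqueDiffOn_convex hJ.convex (OrdConnected.nonempty_interior hJ hJ')

/-- At an endpoint of J the derivatives are one-sided. Their symmetry still holds there because the
point is a limit of interior points. -/
lemma OrdConnected.prod_subset_closure_interior {A J : Set ℝ} (hA : IsOpen A)
    (hJ : J.OrdConnected) (hJ' : J.Nontrivial) : A ×ˢ J ⊆ closure (interior (A ×ˢ J)) := by
  rw [interior_prod_eq, closure_prod_eq, hA.interior_eq,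
    (hJ.convex (𝕜 := ℝ)).closure_interior_eq_closure_of_nonempty_interior
      (OrdConnected.nonempty_interior hJ hJ')]
  exact prod_mono subset_closure subset_closure

lemma HasFDerivWithinAt.clm_apply_vector {F' G : Type*} [NormedAddCommGroup F']
    [NormedSpace ℝ F'] [NormedAddCommGroup G] [NormedSpace ℝ G] {c : G → F →L[ℝ] F'}
    {c' : G →L[ℝ] F →L[ℝ] F'} {K : Set G} {q : G} (hc : HasFDerivWithinAt c c' K q) (b : F) :
    HasFDerivWithinAt (fun z => c z b) (c'.flip b) K q :=
  ((ContinuousLinearMap.apply ℝ F' b).hasFDerivAt.comp_hasFDerivWithinAt q hc).congr_fderiv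
    (by ext; rfl)

end Slices

/-! ### Variations in a chart, the commutation identity and the Jacobi equation -/

section Variations

variable {E : Type*} [NormedAddCommGroup E] [NormedSpace ℝ E]
  {M : Type*} [TopologicalSpace M] [ChartedSpace E M] [IsManifold 𝓘(ℝ, E) ∞ M]
  {S : (w : TangentBundle 𝓘(ℝ, E) M) → TTangent w} {D : VerticalConnection E M}
  {H : ℝ → ℝ → M} {ε : ℝ} {J : Set ℝ} {p : M} {s t : ℝ}

/-- Values outside J are arbitrary, so fields can be identified only on J; the derivative within J
sees no more. -/
lemma VerticalConnection.covAlong_congr {γ : ℝ → M}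
    {W V V' : (t : ℝ) → TangentSpace 𝓘(ℝ, E) (γ t)} (ht : t ∈ J) (h : ∀ τ ∈ J, V τ = V' τ) :
    D.covAlong S γ J W V t = D.covAlong S γ J W V' t := by
  have h1 : ∀ τ ∈ J, (trivializationAt E (TangentSpace 𝓘(ℝ, E)) (γ t)
        (⟨γ τ, V τ⟩ : TangentBundle 𝓘(ℝ, E) M)).2 =
      (trivializationAt E (TangentSpace 𝓘(ℝ, E)) (γ t)
        (⟨γ τ, V' τ⟩ : TangentBundle 𝓘(ℝ, E) M)).2 := fun τ hτ => by rw [h τ hτ]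
  rw [covAlong, covAlong, derivWithin_congr h1 (h1 t ht), h t ht]

variable (E) in
/-- The variation `H` read in the preferred chart at `p`. -/
noncomputable def variationCoords (H : ℝ → ℝ → M) (p : M) (q : ℝ × ℝ) : E :=
  extChartAt 𝓘(ℝ, E) p (H q.1 q.2)

namespace IsRegularVariation

lemma contMDiffWithinAt (hH : IsRegularVariation E H ε J) (hs : s ∈ Ioo (-ε) ε) (ht : t ∈ J) :
    ContMDiffWithinAt 𝓘(ℝ, ℝ × ℝ) 𝓘(ℝ, E) ∞ (fun q : ℝ × ℝ => H q.1 q.2)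
      (Ioo (-ε) ε ×ˢ J) (s, t) :=
  hH.smooth (s, t) ⟨hs, ht⟩

lemma contDiffWithinAt_variationCoords (hH : IsRegularVariation E H ε J)
    (hs : s ∈ Ioo (-ε) ε) (ht : t ∈ J) (hp : H s t ∈ (extChartAt 𝓘(ℝ, E) p).source) :
    ContDiffWithinAt ℝ ∞ (variationCoords E H p) (Ioo (-ε) ε ×ˢ J) (s, t) := by
  rw [← contMDiffWithinAt_iff_contDiffWithinAt]
  have h : ContMDiffAt 𝓘(ℝ, E) 𝓘(ℝ, E) ∞ (extChartAt 𝓘(ℝ, E) p) (H s t) :=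
    contMDiffAt_extChartAt' (by rwa [extChartAt_source] at hp)
  exact ContMDiffAt.comp_contMDiffWithinAt (g := extChartAt 𝓘(ℝ, E) p)
    (f := fun q : ℝ × ℝ => H q.1 q.2) (s, t) h (hH.contMDiffWithinAt hs ht)

lemma mdifferentiableWithinAt_snd (hH : IsRegularVariation E H ε J)
    (hs : s ∈ Ioo (-ε) ε) (ht : t ∈ J) :
    MDifferentiableWithinAt 𝓘(ℝ, ℝ) 𝓘(ℝ, E) (fun τ => H s τ) J t := by
  have h1 : ContMDiffWithinAt 𝓘(ℝ, ℝ) 𝓘(ℝ, ℝ × ℝ) ∞ (fun τ : ℝ => (s, τ)) J t :=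
    (contDiff_const.prodMk contDiff_id).contMDiff.contMDiffAt.contMDiffWithinAt
  have h2 : MapsTo (fun τ : ℝ => (s, τ)) J (Ioo (-ε) ε ×ˢ J) := fun _ hτ => ⟨hs, hτ⟩
  exact (ContMDiffWithinAt.comp (g := fun q : ℝ × ℝ => H q.1 q.2) t
    (hH.contMDiffWithinAt hs ht) h1 h2).mdifferentiableWithinAt (by simp)

lemma mdifferentiableWithinAt_fst (hH : IsRegularVariation E H ε J)
    (hs : s ∈ Ioo (-ε) ε) (ht : t ∈ J) :
    MDifferentiableWithinAt 𝓘(ℝ, ℝ) 𝓘(ℝ, E) (fun σ => H σ t) (Ioo (-ε) ε) s := by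
  have h1 : ContMDiffWithinAt 𝓘(ℝ, ℝ) 𝓘(ℝ, ℝ × ℝ) ∞ (fun σ : ℝ => (σ, t)) (Ioo (-ε) ε) s :=
    (contDiff_id.prodMk contDiff_const).contMDiff.contMDiffAt.contMDiffWithinAt
  have h2 : MapsTo (fun σ : ℝ => (σ, t)) (Ioo (-ε) ε) (Ioo (-ε) ε ×ˢ J) := fun _ hσ => ⟨hσ, ht⟩
  exact (ContMDiffWithinAt.comp (g := fun q : ℝ × ℝ => H q.1 q.2)
    (f := fun σ : ℝ => (σ, t)) s
    (hH.contMDiffWithinAt hs ht) h1 h2).mdifferentiableWithinAt (by simp)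

lemma coords_fieldT (hJ : UniqueDiffOn ℝ J) (hH : IsRegularVariation E H ε J)
    (hs : s ∈ Ioo (-ε) ε) (ht : t ∈ J) (hp : H s t ∈ (extChartAt 𝓘(ℝ, E) p).source) :
    coords 𝓘(ℝ, E) p (H s t) (fieldT H J s t) =
      fderivWithin ℝ (variationCoords E H p) (Ioo (-ε) ε ×ˢ J) (s, t) (0, 1) :=
  (hJ t ht).eq_deriv _ (hasDerivWithinAt_velocity (hH.mdifferentiableWithinAt_snd hs ht) hp)
    (HasFDerivWithinAt.hasDerivWithinAt_slice_snd
      ((hH.contDiffWithinAt_variationCoords hs ht hp).differentiableWithinAt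
        (by simp)).hasFDerivWithinAt hs)

lemma coords_fieldU (hH : IsRegularVariation E H ε J)
    (hs : s ∈ Ioo (-ε) ε) (ht : t ∈ J) (hp : H s t ∈ (extChartAt 𝓘(ℝ, E) p).source) :
    coords 𝓘(ℝ, E) p (H s t) (fieldU H ε s t) =
      fderivWithin ℝ (variationCoords E H p) (Ioo (-ε) ε ×ˢ J) (s, t) (1, 0) :=
  (isOpen_Ioo.uniqueDiffWithinAt hs).eq_deriv _
    (hasDerivWithinAt_velocity (hH.mdifferentiableWithinAt_fst hs ht) hp)
    (HasFDerivWithinAt.hasDerivWithinAt_slice_fst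
      ((hH.contDiffWithinAt_variationCoords hs ht hp).differentiableWithinAt
        (by simp)).hasFDerivWithinAt ht)

end IsRegularVariation

variable (E) in
/-- The first derivative of a variation read in the preferred chart at `p`. -/
noncomputable def variationDeriv (H : ℝ → ℝ → M) (ε : ℝ) (J : Set ℝ) (p : M) :
    ℝ × ℝ → ℝ × ℝ →L[ℝ] E :=
  fderivWithin ℝ (variationCoords E H p) (Ioo (-ε) ε ×ˢ J)

variable (E) in
/-- The second derivative of a variation read in the preferred chart at `p`. -/
noncomputable def variationDeriv₂ (H : ℝ → ℝ → M) (ε : ℝ) (J : Set ℝ) (p : M) :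
    ℝ × ℝ → ℝ × ℝ →L[ℝ] ℝ × ℝ →L[ℝ] E :=
  fderivWithin ℝ (variationDeriv E H ε J p) (Ioo (-ε) ε ×ˢ J)

namespace IsRegularVariation

lemma contDiffWithinAt_variationDeriv (hJ : UniqueDiffOn ℝ J) (hH : IsRegularVariation E H ε J)
    (hs : s ∈ Ioo (-ε) ε) (ht : t ∈ J) (hp : H s t ∈ (extChartAt 𝓘(ℝ, E) p).source) :
    ContDiffWithinAt ℝ ∞ (variationDeriv E H ε J p) (Ioo (-ε) ε ×ˢ J) (s, t) :=
  (hH.contDiffWithinAt_variationCoords hs ht hp).fderivWithin_right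
    (isOpen_Ioo.uniqueDiffOn.prod hJ) (by simp) ⟨hs, ht⟩

lemma contDiffWithinAt_variationDeriv₂ (hJ : UniqueDiffOn ℝ J) (hH : IsRegularVariation E H ε J)
    (hs : s ∈ Ioo (-ε) ε) (ht : t ∈ J) (hp : H s t ∈ (extChartAt 𝓘(ℝ, E) p).source) :
    ContDiffWithinAt ℝ ∞ (variationDeriv₂ E H ε J p) (Ioo (-ε) ε ×ˢ J) (s, t) :=
  (hH.contDiffWithinAt_variationDeriv hJ hs ht hp).fderivWithin_right
    (isOpen_Ioo.uniqueDiffOn.prod hJ) (by simp) ⟨hs, ht⟩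

lemma hasFDerivWithinAt_variationDeriv (hJ : UniqueDiffOn ℝ J) (hH : IsRegularVariation E H ε J)
    (hs : s ∈ Ioo (-ε) ε) (ht : t ∈ J) (hp : H s t ∈ (extChartAt 𝓘(ℝ, E) p).source) :
    HasFDerivWithinAt (variationDeriv E H ε J p) (variationDeriv₂ E H ε J p (s, t))
      (Ioo (-ε) ε ×ˢ J) (s, t) :=
  ((hH.contDiffWithinAt_variationDeriv hJ hs ht hp).differentiableWithinAt
    (by simp)).hasFDerivWithinAt

lemma hasFDerivWithinAt_variationDeriv₂_apply (hJ : UniqueDiffOn ℝ J)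
    (hH : IsRegularVariation E H ε J) (hs : s ∈ Ioo (-ε) ε) (ht : t ∈ J)
    (hp : H s t ∈ (extChartAt 𝓘(ℝ, E) p).source) (a b : ℝ × ℝ) :
    HasFDerivWithinAt (fun q => variationDeriv₂ E H ε J p q a b)
      (((fderivWithin ℝ (variationDeriv₂ E H ε J p) (Ioo (-ε) ε ×ˢ J) (s, t)).flip a).flip b)
      (Ioo (-ε) ε ×ˢ J) (s, t) :=
  HasFDerivWithinAt.clm_apply_vector (HasFDerivWithinAt.clm_apply_vector
    ((hH.contDiffWithinAt_variationDeriv₂ hJ hs ht hp).differentiableWithinAt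
      (by simp)).hasFDerivWithinAt a) b

/-- The first direction is the one differentiated last: the arguments (1, 0), (0, 1) mean ∂_s∂_t.
Symmetry is what makes D^T U/dt equal to D^T T/ds. -/
lemma variationDeriv₂_comm (hJc : J.OrdConnected) (hJn : J.Nontrivial)
    (hH : IsRegularVariation E H ε J) (hs : s ∈ Ioo (-ε) ε) (ht : t ∈ J)
    (hp : H s t ∈ (extChartAt 𝓘(ℝ, E) p).source) (a b : ℝ × ℝ) :
    variationDeriv₂ E H ε J p (s, t) a b = variationDeriv₂ E H ε J p (s, t) b a :=
  ((hH.contDiffWithinAt_variationCoords hs ht hp).isSymmSndFDerivWithinAt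
    (by simpa using ENat.LEInfty.out)
    (isOpen_Ioo.uniqueDiffOn.prod (OrdConnected.uniqueDiffOn hJc hJn))
    (OrdConnected.prod_subset_closure_interior isOpen_Ioo hJc hJn ⟨hs, ht⟩) ⟨hs, ht⟩).eq _ _

/-- Swaps the two outermost of the three derivatives. With (0, 1) as innermost direction this is
∂_s∂_t h_t = ∂_t∂_s h_t, the cancellation needed in the commutator. -/
lemma fderivWithin_variationDeriv₂_comm (hJc : J.OrdConnected) (hJn : J.Nontrivial)
    (hH : IsRegularVariation E H ε J) (hs : s ∈ Ioo (-ε) ε) (ht : t ∈ J)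
    (hp : H s t ∈ (extChartAt 𝓘(ℝ, E) p).source) (a b : ℝ × ℝ) :
    fderivWithin ℝ (variationDeriv₂ E H ε J p) (Ioo (-ε) ε ×ˢ J) (s, t) a b =
      fderivWithin ℝ (variationDeriv₂ E H ε J p) (Ioo (-ε) ε ×ˢ J) (s, t) b a :=
  ((hH.contDiffWithinAt_variationDeriv (OrdConnected.uniqueDiffOn hJc hJn)
      hs ht hp).isSymmSndFDerivWithinAt
    (by simpa using ENat.LEInfty.out)
    (isOpen_Ioo.uniqueDiffOn.prod (OrdConnected.uniqueDiffOn hJc hJn))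
    (OrdConnected.prod_subset_closure_interior isOpen_Ioo hJc hJn ⟨hs, ht⟩) ⟨hs, ht⟩).eq _ _

lemma eventually_snd (hH : IsRegularVariation E H ε J) (hs : s ∈ Ioo (-ε) ε) (ht : t ∈ J)
    (hp : H s t ∈ (extChartAt 𝓘(ℝ, E) p).source) :
    ∀ᶠ τ in 𝓝[J] t, τ ∈ J ∧ H s τ ∈ (extChartAt 𝓘(ℝ, E) p).source :=
  Filter.Eventually.and self_mem_nhdsWithin
    ((hH.mdifferentiableWithinAt_snd hs ht).continuousWithinAt.preimage_mem_nhdsWithin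
      ((isOpen_extChartAt_source (I := 𝓘(ℝ, E)) p).mem_nhds hp))

lemma eventually_fst (hH : IsRegularVariation E H ε J) (hs : s ∈ Ioo (-ε) ε) (ht : t ∈ J)
    (hp : H s t ∈ (extChartAt 𝓘(ℝ, E) p).source) :
    ∀ᶠ σ in 𝓝[Ioo (-ε) ε] s, σ ∈ Ioo (-ε) ε ∧ H σ t ∈ (extChartAt 𝓘(ℝ, E) p).source :=
  Filter.Eventually.and self_mem_nhdsWithin
    ((hH.mdifferentiableWithinAt_fst hs ht).continuousWithinAt.preimage_mem_nhdsWithin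
      ((isOpen_extChartAt_source (I := 𝓘(ℝ, E)) p).mem_nhds hp))

lemma hasDerivWithinAt_coords_fieldT_snd (hJ : UniqueDiffOn ℝ J)
    (hH : IsRegularVariation E H ε J) (hs : s ∈ Ioo (-ε) ε) (ht : t ∈ J)
    (hp : H s t ∈ (extChartAt 𝓘(ℝ, E) p).source) :
    HasDerivWithinAt (fun τ => coords 𝓘(ℝ, E) p (H s τ) (fieldT H J s τ))
      (variationDeriv₂ E H ε J p (s, t) (0, 1) (0, 1)) J t := by
  have h1 := (HasFDerivWithinAt.hasDerivWithinAt_slice_snd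
    (hH.hasFDerivWithinAt_variationDeriv hJ hs ht hp) hs).clm_apply
    (hasDerivWithinAt_const t J ((0, 1) : ℝ × ℝ))
  rw [map_zero, add_zero] at h1
  have h2 := (hH.eventually_snd hs ht hp).mono fun τ hτ => hH.coords_fieldT hJ hs hτ.1 hτ.2
  exact h1.congr_of_eventuallyEq h2 (Filter.EventuallyEq.eq_of_nhdsWithin h2 ht)

lemma hasDerivWithinAt_coords_fieldT_fst (hJ : UniqueDiffOn ℝ J)
    (hH : IsRegularVariation E H ε J) (hs : s ∈ Ioo (-ε) ε) (ht : t ∈ J)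
    (hp : H s t ∈ (extChartAt 𝓘(ℝ, E) p).source) :
    HasDerivWithinAt (fun σ => coords 𝓘(ℝ, E) p (H σ t) (fieldT H J σ t))
      (variationDeriv₂ E H ε J p (s, t) (1, 0) (0, 1)) (Ioo (-ε) ε) s := by
  have h1 := (HasFDerivWithinAt.hasDerivWithinAt_slice_fst
    (hH.hasFDerivWithinAt_variationDeriv hJ hs ht hp) ht).clm_apply
    (hasDerivWithinAt_const s (Ioo (-ε) ε) ((0, 1) : ℝ × ℝ))
  rw [map_zero, add_zero] at h1
  have h2 := (hH.eventually_fst hs ht hp).mono fun σ hσ => hH.coords_fieldT hJ hσ.1 ht hσ.2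
  exact h1.congr_of_eventuallyEq h2 (Filter.EventuallyEq.eq_of_nhdsWithin h2 hs)

lemma hasDerivWithinAt_coords_fieldU_snd (hJ : UniqueDiffOn ℝ J)
    (hH : IsRegularVariation E H ε J) (hs : s ∈ Ioo (-ε) ε) (ht : t ∈ J)
    (hp : H s t ∈ (extChartAt 𝓘(ℝ, E) p).source) :
    HasDerivWithinAt (fun τ => coords 𝓘(ℝ, E) p (H s τ) (fieldU H ε s τ))
      (variationDeriv₂ E H ε J p (s, t) (0, 1) (1, 0)) J t := by
  have h1 := (HasFDerivWithinAt.hasDerivWithinAt_slice_snd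
    (hH.hasFDerivWithinAt_variationDeriv hJ hs ht hp) hs).clm_apply
    (hasDerivWithinAt_const t J ((1, 0) : ℝ × ℝ))
  rw [map_zero, add_zero] at h1
  have h2 := (hH.eventually_snd hs ht hp).mono fun τ hτ => hH.coords_fieldU hs hτ.1 hτ.2
  exact h1.congr_of_eventuallyEq h2 (Filter.EventuallyEq.eq_of_nhdsWithin h2 ht)

lemma mem_chartSlit (hH : IsRegularVariation E H ε J) (hs : s ∈ Ioo (-ε) ε) (ht : t ∈ J)
    (hp : H s t ∈ (extChartAt 𝓘(ℝ, E) p).source) :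
    (⟨H s t, fieldT H J s t⟩ : TangentBundle 𝓘(ℝ, E) M) ∈ chartSlit E p :=
  ⟨hp, hH.regular s hs t ht⟩

lemma bundleChart_fieldT (hJ : UniqueDiffOn ℝ J) (hH : IsRegularVariation E H ε J)
    (hs : s ∈ Ioo (-ε) ε) (ht : t ∈ J) (hp : H s t ∈ (extChartAt 𝓘(ℝ, E) p).source) :
    bundleChart E p ⟨H s t, fieldT H J s t⟩ =
      (variationCoords E H p (s, t), variationDeriv E H ε J p (s, t) (0, 1)) := by
  rw [bundleChart_apply hp, hH.coords_fieldT hJ hs ht hp]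
  rfl

lemma mem_slitDomain (hJ : UniqueDiffOn ℝ J) (hH : IsRegularVariation E H ε J)
    (hs : s ∈ Ioo (-ε) ε) (ht : t ∈ J) (hp : H s t ∈ (extChartAt 𝓘(ℝ, E) p).source) :
    (variationCoords E H p (s, t), variationDeriv E H ε J p (s, t) (0, 1)) ∈ slitDomain E p := by
  rw [← hH.bundleChart_fieldT hJ hs ht hp]
  exact bundleChart_mem_slitDomain (hH.mem_chartSlit hs ht hp)

lemma variationDeriv₂_eq_sprayCoeff (hJ : UniqueDiffOn ℝ J) (hH : IsRegularVariation E H ε J)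
    (hs : s ∈ Ioo (-ε) ε) (ht : t ∈ J) (hp : H s t ∈ (extChartAt 𝓘(ℝ, E) p).source)
    (hg : IsGeodesicOn S (H s) J) :
    variationDeriv₂ E H ε J p (s, t) (0, 1) (0, 1) =
      sprayCoeff S p (variationCoords E H p (s, t), variationDeriv E H ε J p (s, t) (0, 1)) := by
  have h1 := hg.hasDerivWithinAt_velocity ht hp
  have h2 := (hJ t ht).eq_deriv _ (hH.hasDerivWithinAt_coords_fieldT_snd hJ hs ht hp) h1
  rw [h2]
  exact congrArg (fun y => sprayCoeff S p (extChartAt 𝓘(ℝ, E) p (H s t), y))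
    (hH.coords_fieldT hJ hs ht hp)

variable [FiniteDimensional ℝ E]

/-- The reference vector and the direction are both T, whose horizontal lift is S. By (T1) the
Christoffel term is N for every field V. -/
lemma coords_covDt (hS : IsSpray S) (hD : D.IsLift S) (hT : D.CondT1 S)
    (hJ : UniqueDiffOn ℝ J) (hH : IsRegularVariation E H ε J)
    (hs : s ∈ Ioo (-ε) ε) (ht : t ∈ J) (hp : H s t ∈ (extChartAt 𝓘(ℝ, E) p).source)
    {V : (s t : ℝ) → TangentSpace 𝓘(ℝ, E) (H s t)} {V' : E}
    (hV : HasDerivWithinAt (fun τ => coords 𝓘(ℝ, E) p (H s τ) (V s τ)) V' J t) :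
    coords 𝓘(ℝ, E) p (H s t) (covDt D S H J V s t) =
      V' + D.nonlinear p (variationCoords E H p (s, t), variationDeriv E H ε J p (s, t) (0, 1))
        (coords 𝓘(ℝ, E) p (H s t) (V s t)) := by
  rw [← hH.bundleChart_fieldT hJ hs ht hp]
  refine (VerticalConnection.coords_covAlong hD ht (hJ t ht)
    (hH.mdifferentiableWithinAt_snd hs ht) hp (hH.regular s hs t ht) hV).trans ?_
  exact congrArg _ (VerticalConnection.christoffel_hlift_self hS hD hT
    (hH.mem_chartSlit hs ht hp) _)

lemma coords_covDt_fieldT (hS : IsSpray S) (hD : D.IsLift S) (hT : D.CondT1 S)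
    (hJ : UniqueDiffOn ℝ J) (hH : IsRegularVariation E H ε J)
    (hs : s ∈ Ioo (-ε) ε) (ht : t ∈ J) (hp : H s t ∈ (extChartAt 𝓘(ℝ, E) p).source) :
    coords 𝓘(ℝ, E) p (H s t) (covDt D S H J (fieldT H J) s t) =
      variationDeriv₂ E H ε J p (s, t) (0, 1) (0, 1) -
        sprayCoeff S p (variationCoords E H p (s, t), variationDeriv E H ε J p (s, t) (0, 1)) := by
  have : CompleteSpace E := FiniteDimensional.complete ℝ E
  rw [hH.coords_covDt hS hD hT hJ hs ht hp (hH.hasDerivWithinAt_coords_fieldT_snd hJ hs ht hp),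
    VerticalConnection.sprayCoeff_eq hS hD (hH.mem_slitDomain hJ hs ht hp), sub_neg_eq_add,
    hH.coords_fieldT hJ hs ht hp]
  rfl

/-- The direction U is arbitrary, but the differentiated field is the reference vector T itself, so
only ∇C enters and (T1) is not needed. -/
lemma coords_covDs_fieldT (hD : D.IsLift S)
    (hJ : UniqueDiffOn ℝ J) (hH : IsRegularVariation E H ε J)
    (hs : s ∈ Ioo (-ε) ε) (ht : t ∈ J) (hp : H s t ∈ (extChartAt 𝓘(ℝ, E) p).source) :
    coords 𝓘(ℝ, E) p (H s t) (covDs D S H ε J (fieldT H J) s t) =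
      variationDeriv₂ E H ε J p (s, t) (1, 0) (0, 1) +
        D.nonlinear p (variationCoords E H p (s, t), variationDeriv E H ε J p (s, t) (0, 1))
          (variationDeriv E H ε J p (s, t) (1, 0)) := by
  rw [← hH.bundleChart_fieldT hJ hs ht hp]
  refine (VerticalConnection.coords_covAlong hD hs (isOpen_Ioo.uniqueDiffWithinAt hs)
    (hH.mdifferentiableWithinAt_fst hs ht) hp (hH.regular s hs t ht)
    (hH.hasDerivWithinAt_coords_fieldT_fst hJ hs ht hp)).trans ?_
  refine congrArg _ ((VerticalConnection.christoffel_hlift_snd hD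
    (hH.mem_chartSlit hs ht hp) _).trans ?_)
  exact congrArg _ (hH.coords_fieldU hs ht hp)

/-- The one case where neither the direction nor the field is T. The Christoffel term is then
uncontrolled, but it is evaluated on zero. -/
lemma coords_covDs_of_eq_zero (hD : D.IsLift S) (hH : IsRegularVariation E H ε J)
    (hs : s ∈ Ioo (-ε) ε) (ht : t ∈ J) (hp : H s t ∈ (extChartAt 𝓘(ℝ, E) p).source)
    {V : (s t : ℝ) → TangentSpace 𝓘(ℝ, E) (H s t)} {V' : E}
    (hV : HasDerivWithinAt (fun σ => coords 𝓘(ℝ, E) p (H σ t) (V σ t)) V' (Ioo (-ε) ε) s)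
    (h0 : coords 𝓘(ℝ, E) p (H s t) (V s t) = 0) :
    coords 𝓘(ℝ, E) p (H s t) (covDs D S H ε J V s t) = V' := by
  refine (VerticalConnection.coords_covAlong hD hs (isOpen_Ioo.uniqueDiffWithinAt hs)
    (hH.mdifferentiableWithinAt_fst hs ht) hp (hH.regular s hs t ht) hV).trans ?_
  have h1 := D.christoffel_zero (hH.mem_chartSlit hs ht hp)
    (hlift S ⟨H s t, fieldT H J s t⟩ (velocity (fun σ => H σ t) (Ioo (-ε) ε) s))
  rw [h0]
  exact (congrArg _ h1).trans (add_zero V')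

lemma covDt_fieldT_eq_zero (hS : IsSpray S) (hD : D.IsLift S) (hT : D.CondT1 S)
    (hJ : UniqueDiffOn ℝ J) (hH : IsRegularVariation E H ε J)
    (hs : s ∈ Ioo (-ε) ε) (ht : t ∈ J) (hg : IsGeodesicOn S (H s) J) :
    covDt D S H J (fieldT H J) s t = 0 := by
  have hp := mem_chart_base (E := E) (H s t)
  refine coords_injective hp ?_
  rw [hH.coords_covDt_fieldT hS hD hT hJ hs ht hp,
    hH.variationDeriv₂_eq_sprayCoeff hJ hs ht hp hg, sub_self, map_zero]

theorem covDs_covDt_sub_covDt_covDs (hS : IsSpray S) (hD : D.IsLift S) (hT : D.CondT1 S)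
    (hε : 0 < ε) (hJc : J.OrdConnected) (hJn : J.Nontrivial) (hH : IsRegularVariation E H ε J)
    (hg : IsGeodesicOn S (H 0) J) (ht : t ∈ J) :
    covDs D S H ε J (covDt D S H J (fieldT H J)) 0 t
        - covDt D S H J (covDs D S H ε J (fieldT H J)) 0 t
      = D.curvatureEndo S ⟨H 0 t, fieldT H J 0 t⟩ (fieldU H ε 0 t) := by
  have : CompleteSpace E := FiniteDimensional.complete ℝ E
  have hJ := OrdConnected.uniqueDiffOn hJc hJn
  have hs : (0 : ℝ) ∈ Ioo (-ε) ε := ⟨by linarith, hε⟩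
  have hp := mem_chart_base (E := E) (H 0 t)
  -- The centre of the chart is kept as an independent variable: the curvature formula needs it to
  -- be H(0, t), but it must stay fixed while s and t vary.
  obtain ⟨p, hpeq⟩ : ∃ p, p = H 0 t := ⟨_, rfl⟩
  rw [← hpeq] at hp
  have hps : H 0 t ∈ (extChartAt 𝓘(ℝ, E) p).source := by rw [← hpeq]; exact hp
  set q₀ : ℝ × ℝ := (0, t)
  set K := Ioo (-ε) ε ×ˢ J with hK
  set h := variationCoords E H p
  set F₁ := variationDeriv E H ε J p with hF₁
  set F₂ := variationDeriv₂ E H ε J p with hF₂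
  set F₃ := fderivWithin ℝ F₂ K q₀ with hF₃
  set N := D.nonlinear p
  set f := sprayCoeff S p
  have hz := hH.mem_slitDomain hJ hs ht hps
  set z₀ : E × E := (h q₀, F₁ q₀ (0, 1)) with hz₀
  have hhd : HasFDerivWithinAt h (F₁ q₀) K q₀ :=
    ((hH.contDiffWithinAt_variationCoords hs ht hps).differentiableWithinAt
      (by simp)).hasFDerivWithinAt
  have hF₁d : ∀ b : ℝ × ℝ, HasFDerivWithinAt (fun q => F₁ q b) ((F₂ q₀).flip b) K q₀ :=
    HasFDerivWithinAt.clm_apply_vector (hH.hasFDerivWithinAt_variationDeriv hJ hs ht hps)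
  have hF₂ab : ∀ a b : ℝ × ℝ, HasFDerivWithinAt (fun q => F₂ q a b) ((F₃.flip a).flip b) K q₀ :=
    hH.hasFDerivWithinAt_variationDeriv₂_apply hJ hs ht hps
  have hzd : HasFDerivWithinAt (fun q => (h q, F₁ q (0, 1)))
      ((F₁ q₀).prod ((F₂ q₀).flip (0, 1))) K q₀ := hhd.prodMk (hF₁d _)
  have hNd : HasFDerivWithinAt (fun q => N (h q, F₁ q (0, 1))) ((fderiv ℝ N z₀).comp
      ((F₁ q₀).prod ((F₂ q₀).flip (0, 1)))) K q₀ :=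
    HasFDerivAt.comp_hasFDerivWithinAt (g := N) (f := fun q => (h q, F₁ q (0, 1))) q₀
      (((D.contDiffOn_nonlinear p).contDiffAt
        ((isOpen_slitDomain p).mem_nhds hz)).differentiableAt (by simp)).hasFDerivAt hzd
  have hfd : HasFDerivWithinAt (fun q => f (h q, F₁ q (0, 1))) ((fderiv ℝ f z₀).comp
      ((F₁ q₀).prod ((F₂ q₀).flip (0, 1)))) K q₀ :=
    HasFDerivAt.comp_hasFDerivWithinAt (g := f) (f := fun q => (h q, F₁ q (0, 1))) q₀
      (differentiableAt_sprayCoeff hS hz).hasFDerivAt hzd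
  have hgeo : F₂ q₀ (0, 1) (0, 1) = f z₀ := hH.variationDeriv₂_eq_sprayCoeff hJ hs ht hps hg
  have hcomm : F₂ q₀ (0, 1) (1, 0) = F₂ q₀ (1, 0) (0, 1) :=
    hH.variationDeriv₂_comm hJc hJn hs ht hps _ _
  have hcomm₃ : F₃ (0, 1) (1, 0) = F₃ (1, 0) (0, 1) :=
    hH.fderivWithin_variationDeriv₂_comm hJc hJn hs ht hps _ _
  have hA := HasFDerivWithinAt.hasDerivWithinAt_slice_fst ((hF₂ab (0, 1) (0, 1)).fun_sub hfd) ht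
  have hB := HasFDerivWithinAt.hasDerivWithinAt_slice_snd
    ((hF₂ab (1, 0) (0, 1)).fun_add (hNd.clm_apply (hF₁d (1, 0)))) hs
  have hA' := (hH.eventually_fst hs ht hps).mono fun σ hσ =>
    hH.coords_covDt_fieldT hS hD hT hJ hσ.1 ht hσ.2
  have hB' := (hH.eventually_snd hs ht hps).mono fun τ hτ =>
    hH.coords_covDs_fieldT hD hJ hs hτ.1 hτ.2
  have hA₀ := Filter.EventuallyEq.eq_of_nhdsWithin hA' hs
  have hB₀ := Filter.EventuallyEq.eq_of_nhdsWithin hB' ht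
  have h1 := hH.coords_covDs_of_eq_zero hD hs ht hps (V := covDt D S H J (fieldT H J))
    (hA.congr_of_eventuallyEq hA' hA₀)
    -- The geodesic equation for λ: D^T T/dt = h_tt - f is zero at (0, t).
    (hA₀.trans (sub_eq_zero.2 hgeo))
  have h2 := hH.coords_covDt hS hD hT hJ hs ht hps (V := covDs D S H ε J (fieldT H J))
    (hB.congr_of_eventuallyEq hB' hB₀)
  have hR := VerticalConnection.coords_curvatureEndo_eq hS hD (p := p)
    (w := ⟨H 0 t, fieldT H J 0 t⟩) hpeq.symm (hH.regular 0 hs t ht) (fieldU H ε 0 t)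
    (F₂ q₀ (1, 0) (0, 1))
  rw [hH.bundleChart_fieldT hJ hs ht hps] at hR
  have hU := hH.coords_fieldU hs ht hps
  have hTT := hH.coords_fieldT hJ hs ht hps
  simp only at hR
  rw [hU, hTT] at hR
  refine coords_injective hps ?_
  rw [map_sub, h1, h2, hB₀]
  refine Eq.trans ?_ hR.symm
  -- The composed and flipped derivatives written as partials: h_stt - df(h_s, h_st) minus the
  -- t-derivative of h_st + N h_s and N of that sum. The right side is `coords_curvatureEndo_eq`
  -- with a = h_st.
  change F₃ (1, 0) (0, 1) (0, 1) - fderiv ℝ f z₀ (F₁ q₀ (1, 0), F₂ q₀ (1, 0) (0, 1)) -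
      (F₃ (0, 1) (1, 0) (0, 1) + (N z₀ (F₂ q₀ (0, 1) (1, 0)) +
        fderiv ℝ N z₀ (F₁ q₀ (0, 1), F₂ q₀ (0, 1) (0, 1)) (F₁ q₀ (1, 0))) +
        N z₀ (F₂ q₀ (1, 0) (0, 1) + N z₀ (F₁ q₀ (1, 0)))) =
    -fderiv ℝ f z₀ (F₁ q₀ (1, 0), F₂ q₀ (1, 0) (0, 1)) -
      fderiv ℝ N z₀ (F₁ q₀ (0, 1), f z₀) (F₁ q₀ (1, 0)) - N z₀ (F₂ q₀ (1, 0) (0, 1)) -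
      N z₀ (F₂ q₀ (1, 0) (0, 1) + N z₀ (F₁ q₀ (1, 0)))
  rw [hcomm₃, hcomm, hgeo]
  abel

/-- The two sides read h_ts + N h_s and h_st + N h_s. The left one comes from (T1), the right one
from ∇C alone. -/
lemma covAlong_fieldU (hS : IsSpray S) (hD : D.IsLift S) (hT : D.CondT1 S)
    (hJc : J.OrdConnected) (hJn : J.Nontrivial) (hH : IsRegularVariation E H ε J)
    (hs : s ∈ Ioo (-ε) ε) (ht : t ∈ J) :
    D.covAlong S (H s) J (velocity (H s) J) (fun τ => fieldU H ε s τ) t =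
      covDs D S H ε J (fieldT H J) s t := by
  have hJ := OrdConnected.uniqueDiffOn hJc hJn
  have hp := mem_chart_base (E := E) (H s t)
  refine coords_injective hp ?_
  have h1 := hH.coords_covDt hS hD hT hJ hs ht hp (V := fieldU H ε)
    (hH.hasDerivWithinAt_coords_fieldU_snd hJ hs ht hp)
  rw [hH.coords_covDs_fieldT hD hJ hs ht hp, ← hH.variationDeriv₂_comm hJc hJn hs ht hp (0, 1)]
  refine h1.trans ?_
  rw [hH.coords_fieldU hs ht hp]
  rfl

/-- The first term of the commutation identity vanishes since D^T T/dt is zero on every curve of the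
variation. In the second, D^T T/ds is replaced by D^T U/dt. -/
theorem jacobi_equation (hS : IsSpray S) (hD : D.IsLift S) (hT : D.CondT1 S)
    (hε : 0 < ε) (hJc : J.OrdConnected) (hJn : J.Nontrivial) (hH : IsRegularVariation E H ε J)
    (hg : ∀ s ∈ Ioo (-ε) ε, IsGeodesicOn S (H s) J) (ht : t ∈ J) :
    D.covAlong S (H 0) J (velocity (H 0) J)
        (D.covAlong S (H 0) J (velocity (H 0) J) (fun τ => fieldU H ε 0 τ)) t
      + D.curvatureEndo S ⟨H 0 t, velocity (H 0) J t⟩ (fieldU H ε 0 t) = 0 := by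
  have hJ := OrdConnected.uniqueDiffOn hJc hJn
  have hs : (0 : ℝ) ∈ Ioo (-ε) ε := ⟨by linarith, hε⟩
  have hp := mem_chart_base (E := E) (H 0 t)
  have h1 : D.covAlong S (H 0) J (velocity (H 0) J)
      (D.covAlong S (H 0) J (velocity (H 0) J) (fun τ => fieldU H ε 0 τ)) t =
      covDt D S H J (covDs D S H ε J (fieldT H J)) 0 t :=
    VerticalConnection.covAlong_congr ht fun τ hτ => hH.covAlong_fieldU hS hD hT hJc hJn hs hτ
  -- No restriction to the chart domain is needed: `coords` is linear at every point, and the vector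
  -- is zero.
  have h2 : ∀ σ ∈ Ioo (-ε) ε, coords 𝓘(ℝ, E) (H 0 t) (H σ t)
      (covDt D S H J (fieldT H J) σ t) = 0 := fun σ hσ => by
    rw [hH.covDt_fieldT_eq_zero hS hD hT hJ hσ ht (hg σ hσ), map_zero]
  have h3 : covDs D S H ε J (covDt D S H J (fieldT H J)) 0 t = 0 := by
    refine coords_injective hp ?_
    rw [hH.coords_covDs_of_eq_zero hD hs ht hp (V := covDt D S H J (fieldT H J)) (V' := 0)
      ((hasDerivWithinAt_const _ _ _).congr h2 (h2 0 hs)) (h2 0 hs), map_zero]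
  have h4 := hH.covDs_covDt_sub_covDt_covDs hS hD hT hε hJc hJn (hg 0 hs) ht
  rw [h3, zero_sub] at h4
  rw [h1]
  exact add_eq_zero_iff_neg_eq.2 h4

end IsRegularVariation

end Variations

end SprayGeometry

theorem mainTheorem2 {E : Type*} [NormedAddCommGroup E] [NormedSpace ℝ E] [FiniteDimensional ℝ E]
    {M : Type*} [TopologicalSpace M] [T2Space M] [ChartedSpace E M] [IsManifold 𝓘(ℝ, E) ∞ M]
    (S : (w : TangentBundle 𝓘(ℝ, E) M) → SprayGeometry.TTangent w) (hS : SprayGeometry.IsSpray S)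
    (D : SprayGeometry.VerticalConnection E M) (hD : D.IsLift S) (hT1 : D.CondT1 S) :
    -- the curvature identity for variations of a geodesic through regular curves
    (∀ (H : ℝ → ℝ → M) (ε : ℝ) (J : Set ℝ), 0 < ε → J.OrdConnected → J.Nontrivial →
      SprayGeometry.IsRegularVariation E H ε J →
      SprayGeometry.IsGeodesicOn S (H 0) J →
      ∀ t ∈ J,
        SprayGeometry.covDs D S H ε J
            (SprayGeometry.covDt D S H J (SprayGeometry.fieldT H J)) 0 t
          - SprayGeometry.covDt D S H J
            (SprayGeometry.covDs D S H ε J (SprayGeometry.fieldT H J)) 0 t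
          = D.curvatureEndo S ⟨H 0 t, SprayGeometry.fieldT H J 0 t⟩
              (SprayGeometry.fieldU H ε 0 t)) ∧
    -- the Jacobi equation for variations through geodesics
    (∀ (H : ℝ → ℝ → M) (ε : ℝ) (J : Set ℝ), 0 < ε → J.OrdConnected → J.Nontrivial →
      SprayGeometry.IsRegularVariation E H ε J →
      (∀ s ∈ Set.Ioo (-ε) ε, SprayGeometry.IsGeodesicOn S (H s) J) →
      ∀ t ∈ J,
        D.covAlong S (H 0) J (SprayGeometry.velocity (H 0) J)
            (D.covAlong S (H 0) J (SprayGeometry.velocity (H 0) J)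
              (fun τ => SprayGeometry.fieldU H ε 0 τ)) t
          + D.curvatureEndo S ⟨H 0 t, SprayGeometry.velocity (H 0) J t⟩
              (SprayGeometry.fieldU H ε 0 t) = 0) ∧
    -- the curvature endomorphism of the affine connection of a vector field
    (∀ (O : Set M) (W U : (x : M) → TangentSpace 𝓘(ℝ, E) x) (x₀ : M),
      IsOpen O → x₀ ∈ O →
      SprayGeometry.SmoothFieldOn W O → SprayGeometry.SmoothFieldOn U O →
      (∀ x ∈ O, W x ≠ 0) →
      (∃ (γ : ℝ → M) (δ : ℝ), 0 < δ ∧ γ 0 = x₀ ∧ (∀ t ∈ Set.Ioo (-δ) δ, γ t ∈ O) ∧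
        IsMIntegralCurveOn γ W (Set.Ioo (-δ) δ) ∧
        SprayGeometry.IsGeodesicOn S γ (Set.Ioo (-δ) δ)) →
      D.affineField S W U (D.affineField S W W W) x₀
          - D.affineField S W W (D.affineField S W U W) x₀
          + D.affineField S W (VectorField.mlieBracket 𝓘(ℝ, E) W U) W x₀
        = D.curvatureEndo S ⟨x₀, W x₀⟩ (U x₀)) := by
  refine ⟨?_, ?_, ?_⟩
  · intro H ε J hε hJc hJn hH hg t ht
    exact hH.covDs_covDt_sub_covDt_covDs hS hD hT1 hε hJc hJn hg ht
  · intro H ε J hε hJc hJn hH hg t ht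
    exact hH.jacobi_equation hS hD hT1 hε hJc hJn hg ht
  · rintro O W U x₀ hO hx₀ hW hU hW0 ⟨γ, δ, hδ, hγ0, -, hγW, hγS⟩
    exact SprayGeometry.VerticalConnection.affineField_curvature hS hD hT1 hO hx₀ hW hU hW0 hδ hγ0
      hγW hγS
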